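/- Let $\Bbbk$ be an algebraically closed field, $\mathbf A$ a finite dimensional $\Bbbk$-algebra, and $\mathsf W$ a finite dimensional $\Bbbk$-central $\mathbf A$-bimodule (i.e. $\lambda x=x\lambda$ for all $\lambda\in\Bbbk$, $x\in\mathsf W$). For a finitely generated projective left $\mathbf A$-module $P$ put $\mathsf W(P)=\operatorname{Hom}_{\mathbf A}(P,\mathsf W\otimes_{\mathbf A}P)$; this is a finite dimensional $\Bbbk$-vector space, considered as an affine space with its Zariski topology. The group $\mathrm{GL}(P,\mathbf A)=\operatorname{Aut}_{\mathbf A}(P)$ acts on $\mathsf W(P)$ by $g\cdot w=(1\otimes g)\,w\,g^{-1}$. Let $\mathsf W\text{-el}$ be the category whose objects are the elements $w\in\mathsf W(P)$ for all finitely generated projective left $\mathbf A$-modules $P$; a morphism from $w\in\mathsf W(P)$ to $w'\in\mathsf W(P')$ is a homomorphism of $\mathbf A$-modules $\alpha:P\to P'$ such that $(1\otimes\alpha)w=w'\alpha$, and composition is the composition of maps. The direct sum $w\oplus v\in\mathsf W(P\oplus Q)$ of $w\in\mathsf W(P)$ and $v\in\mathsf W(Q)$ is the direct sum of the two maps, via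 $\mathsf W\otimes_{\mathbf A}(P\oplus Q)\simeq(\mathsf W\otimes_{\mathbf A}P)\oplus(\mathsf W\otimes_{\mathbf A}Q)$. A pair of morphisms $w_1\xrightarrow{\alpha}w_2\xrightarrow{\beta}w_3$ with $w_i\in\mathsf W(P_i)$ is called a conflation if the underlying sequence of modules $0\to P_1\xrightarrow{\alpha}P_2\xrightarrow{\beta}P_3\to0$ is exact. **Theorem.** Let $P$ be a finitely generated projective left $\mathbf A$-module and $w,w'\in\mathsf W(P)$. The following conditions are equivalent: 1. $w'$ lies in the Zariski closure of the orbit $\mathrm{GL}(P,\mathbf A)\cdot w$ in $\mathsf W(P)$. 2. There is an object $v\in\mathsf W\text{-el}$ and a conflation $w'\to w\oplus v\to v$. 3. There is an object $v\in\mathsf W\text{-el}$ and a conflation $v\to w\oplus v\to w'$. -/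

import Mathlib

open CategoryTheory
open scoped TensorProduct

universe u

namespace BimoduleEl

section Tensor

variable (k A W : Type u) [Field k] [Ring A] [Algebra k A]
  [AddCommGroup W] [Module k W] [Module A W] [Module Aᵐᵒᵖ W]
  [IsScalarTower k A W] [IsScalarTower k Aᵐᵒᵖ W] [SMulCommClass A Aᵐᵒᵖ W]

/-- The left `A`-submodule of `W ⊗[k] P` generated by the elements `w a ⊗ p - w ⊗ a p`.
(Since left and right multiplications on `W` commute, it is also their additive span.) -/
def balancedRel (P : Type u) [AddCommGroup P] [Module k P] [Module A P] [IsScalarTower k A P] :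
    Submodule A (W ⊗[k] P) :=
  Submodule.span A
    {x | ∃ (w : W) (a : A) (p : P), x = (MulOpposite.op a • w) ⊗ₜ[k] p - w ⊗ₜ[k] (a • p)}

/-- The tensor product `W ⊗_A P` of the `A`-bimodule `W` (`A` not necessarily commutative) with
the left `A`-module `P`, as a left `A`-module. -/
abbrev BTensor (P : Type u) [AddCommGroup P] [Module k P] [Module A P] [IsScalarTower k A P] :
    Type u :=
  (W ⊗[k] P) ⧸ balancedRel k A W P

variable {P P' P'' : Type u}
  [AddCommGroup P] [Module k P] [Module A P] [IsScalarTower k A P]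
  [AddCommGroup P'] [Module k P'] [Module A P'] [IsScalarTower k A P']
  [AddCommGroup P''] [Module k P''] [Module A P''] [IsScalarTower k A P'']

/-- The `A`-linear map `1 ⊗ α : W ⊗_A P → W ⊗_A P'`. -/
def bmap (α : P →ₗ[A] P') : BTensor k A W P →ₗ[A] BTensor k A W P' :=
  Submodule.mapQ _ _
    (TensorProduct.AlgebraTensorModule.map (LinearMap.id : W →ₗ[A] W) (α.restrictScalars k))
    (by
      refine Submodule.span_le.2 ?_
      rintro _ ⟨w, a, p, rfl⟩
      refine Submodule.subset_span ⟨w, a, α p, ?_⟩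
      simp)

theorem bmap_ext {X : Type u} [AddCommGroup X] [Module A X] {f g : BTensor k A W P →ₗ[A] X}
    (h : ∀ (w : W) (p : P), f (Submodule.Quotient.mk (w ⊗ₜ[k] p)) =
      g (Submodule.Quotient.mk (w ⊗ₜ[k] p))) : f = g := by
  refine LinearMap.ext fun y => ?_
  obtain ⟨x, rfl⟩ := Submodule.Quotient.mk_surjective _ y
  induction x using TensorProduct.induction_on with
  | zero => simp
  | tmul w p => exact h w p
  | add x y hx hy => simp only [Submodule.Quotient.mk_add, map_add, hx, hy]

theorem bmap_id : bmap k A W (LinearMap.id : P →ₗ[A] P) = LinearMap.id :=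
  bmap_ext k A W fun _ _ => rfl

theorem bmap_comp (β : P' →ₗ[A] P'') (α : P →ₗ[A] P') :
    bmap k A W (β ∘ₗ α) = bmap k A W β ∘ₗ bmap k A W α :=
  bmap_ext k A W fun _ _ => rfl

variable (P) in
/-- The `k`-vector space `W(P) = Hom_A(P, W ⊗_A P)`. -/
abbrev Elts : Type u := P →ₗ[A] BTensor k A W P

/-- The direct sum `w ⊕ v ∈ W(P ⊕ P')` of `w ∈ W(P)` and `v ∈ W(P')`. -/
def sumElt (w : Elts k A W P) (v : Elts k A W P') : Elts k A W (P × P') :=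
  bmap k A W (LinearMap.inl A P P') ∘ₗ w ∘ₗ LinearMap.fst A P P' +
    bmap k A W (LinearMap.inr A P P') ∘ₗ v ∘ₗ LinearMap.snd A P P'

end Tensor

section Category

variable (k A W : Type u) [Field k] [Ring A] [Algebra k A]
  [AddCommGroup W] [Module k W] [Module A W] [Module Aᵐᵒᵖ W]
  [IsScalarTower k A W] [IsScalarTower k Aᵐᵒᵖ W] [SMulCommClass A Aᵐᵒᵖ W]

/-- An object of `W-el`: a finitely generated projective left `A`-module `P` together with an
element of `W(P)`. -/
structure El where
  /-- The underlying module. -/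
  carrier : Type u
  [addCommGroup : AddCommGroup carrier]
  [moduleBase : Module k carrier]
  [module : Module A carrier]
  [isScalarTower : IsScalarTower k A carrier]
  [finite : Module.Finite A carrier]
  [projective : Module.Projective A carrier]
  /-- The element of `W(P)`. -/
  elt : Elts k A W carrier

attribute [instance] El.addCommGroup El.moduleBase El.module El.isScalarTower El.finite
  El.projective

variable {k A W}

/-- A morphism of `W-el` from `w ∈ W(P)` to `w' ∈ W(P')`: a homomorphism `α : P → P'` of
`A`-modules with `(1 ⊗ α) w = w' α`. -/
@[ext]
structure El.Hom (X Y : El k A W) where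
  /-- The underlying homomorphism of `A`-modules. -/
  map : X.carrier →ₗ[A] Y.carrier
  comm : bmap k A W map ∘ₗ X.elt = Y.elt ∘ₗ map

/-- The category `W-el`; composition is composition of maps. -/
instance El.category : Category (El k A W) where
  Hom X Y := El.Hom X Y
  id X := ⟨LinearMap.id, by rw [bmap_id]; rfl⟩
  comp {X Y Z} f g := ⟨g.map ∘ₗ f.map, by
    rw [bmap_comp, LinearMap.comp_assoc, f.comm, ← LinearMap.comp_assoc, g.comm,
      LinearMap.comp_assoc]⟩

/-- The object `w ⊕ v` of `W-el`. -/
abbrev El.dsum (X Y : El k A W) : El k A W where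
  carrier := X.carrier × Y.carrier
  elt := sumElt k A W X.elt Y.elt

/-- A pair of composable morphisms `X ⟶ Y ⟶ Z` of `W-el` is a conflation if the underlying
sequence of modules `0 → P₁ → P₂ → P₃ → 0` is exact. -/
def IsConflation {X Y Z : El k A W} (α : X ⟶ Y) (β : Y ⟶ Z) : Prop :=
  Function.Injective (El.Hom.map α) ∧ Function.Exact (El.Hom.map α) (El.Hom.map β) ∧
    Function.Surjective (El.Hom.map β)

end Category

section Zariski

variable (k V : Type u) [Field k] [AddCommGroup V] [Module k V]

/-- The algebra of polynomial functions on a finite dimensional vector space `V`, i.e. the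
`k`-algebra of functions generated by the linear forms. -/
def polyFun : Subalgebra k (V → k) :=
  Algebra.adjoin k (Set.range fun φ : Module.Dual k V => (φ : V → k))

/-- The set of common zeros in `V` of a set of functions. -/
def zeroLocus (I : Set (V → k)) : Set V := {x | ∀ f ∈ I, f x = 0}

/-- The Zariski topology on a finite dimensional vector space `V`: the closed subsets are the
sets of common zeros of sets of polynomial functions. -/
@[reducible]
def zariskiTopology : TopologicalSpace V :=
  TopologicalSpace.ofClosed {Z | ∃ I : Set (V → k), I ⊆ polyFun k V ∧ Z = zeroLocus k V I}
    ⟨{1}, Set.singleton_subset_iff.2 (one_mem (polyFun k V)), by ext x; simp [zeroLocus]⟩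
    (by
      intro C hC
      refine ⟨{f | f ∈ polyFun k V ∧ ∃ Z ∈ C, ∀ x ∈ Z, f x = 0}, fun f hf => hf.1, ?_⟩
      ext x
      constructor
      · rintro hx f ⟨_, Z, hZ, hf⟩
        exact hf x (hx Z hZ)
      · intro hx Z hZ
        obtain ⟨I, hI, rfl⟩ := hC hZ
        exact fun f hf => hx f ⟨hI hf, _, hZ, fun y hy => hy f hf⟩)
    (by
      rintro _ ⟨I, hI, rfl⟩ _ ⟨J, hJ, rfl⟩
      refine ⟨{h | ∃ f ∈ I, ∃ g ∈ J, h = f * g}, ?_, ?_⟩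
      · rintro _ ⟨f, hf, g, hg, rfl⟩
        exact mul_mem (hI hf) (hJ hg)
      · ext x
        constructor
        · rintro (hx | hx) _ ⟨f, hf, g, hg, rfl⟩
          · simp [hx f hf]
          · simp [hx g hg]
        · intro hx
          by_contra hne
          obtain ⟨hne₁, hne₂⟩ := not_or.1 hne
          obtain ⟨f, hf, hfx⟩ : ∃ f ∈ I, f x ≠ 0 := by
            by_contra! h
            exact hne₁ h
          obtain ⟨g, hg, hgx⟩ : ∃ f ∈ J, f x ≠ 0 := by
            by_contra! h
            exact hne₂ h
          exact mul_ne_zero hfx hgx (hx _ ⟨f, hf, g, hg, rfl⟩))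

end Zariski

section Degeneration

variable {k A W : Type u} [Field k] [Ring A] [Algebra k A]
  [AddCommGroup W] [Module k W] [Module A W] [Module Aᵐᵒᵖ W]
  [IsScalarTower k A W] [IsScalarTower k Aᵐᵒᵖ W] [SMulCommClass A Aᵐᵒᵖ W]
  {P : Type u} [AddCommGroup P] [Module k P] [Module A P] [IsScalarTower k A P]

/-- The action `g · w = (1 ⊗ g) w g⁻¹` of `GL(P, A) = Aut_A(P)` on `W(P)`. -/
def glAct (g : P ≃ₗ[A] P) (w : Elts k A W P) : Elts k A W P :=
  bmap k A W (g : P →ₗ[A] P) ∘ₗ w ∘ₗ (g.symm : P →ₗ[A] P)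

/-- The orbit of `w ∈ W(P)` under `GL(P, A)`. -/
def glOrbit (w : Elts k A W P) : Set (Elts k A W P) :=
  Set.range fun g : P ≃ₗ[A] P => glAct g w

/-- `w'` is a degeneration of `w`: it lies in the closure of the `GL(P, A)`-orbit of `w` in the
Zariski topology of `W(P)`. -/
def Degenerates (w w' : Elts k A W P) : Prop :=
  w' ∈ @closure (Elts k A W P) (zariskiTopology k (Elts k A W P)) (glOrbit w)

end Degeneration

end BimoduleEl

/-!
# Degenerations of elements of a bimodule

The argument transports the theorem of Riedtmann and Zwara on degenerations of modules to `W`-el.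
Write `E = End_A(P)`.

**From a degeneration to conflations.** Suppose `w'` lies in the closure of the orbit of `w`. Then
there are a commutative domain `O` over `k`, an augmentation `ε : O → k` whose kernel is generated
by one nonzero `t`, and a `g ∈ E ⊗ O`, invertible up to the factor `t ^ N`, such that `g w g⁻¹` has
coordinates in `O` and specialises to `w'` at `ε` (`BimoduleEl.Arc`, `BimoduleEl.exists_arc`). On
`Q`, the module `P ⊗ O`, there are then two elements, the constant family `w_Q` given by `w` and the
family `u_Q` given by `g w g⁻¹`; `g : w_Q → u_Q` and `h = t ^ N g⁻¹ : u_Q → w_Q` are injective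
morphisms, and reduction modulo `t` turns `w_Q` into `w` and `u_Q` into `w'`. The required objects
`v` are the elements induced on the cokernels: `Q / h Q` gives the conflation `w' → w ⊕ v → v` and
`Q / g Q` the conflation `v → w ⊕ v → w'` (`LatticeData.exists_conflation_right`,
`LatticeData.exists_conflation_left`). The map `b ↦ (b - ε b) / t` on `O` induces a `d` on `Q` with
`d t = 1`; it makes `d ^ N h` and `d ^ N g` retractions of `g` and `h`, so the cokernels are direct
summands of the projective module `Q`. They are finitely generated since `t ^ N` kills them.

**The arc.** Inverting the determinant of left multiplication gives the coordinate ring `T` of the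
unit group of `E`, with its generic unit (`exists_generic_unit`), and an orbit map to `W(P)`. That
`w'` lies in the closure of the orbit means that its coordinates satisfy all polynomial relations
between the coordinates of the orbit map. A valuation ring of `Frac T` dominating the corresponding
maximal ideal yields a finitely generated `B ⊆ Frac T` which contains these coordinates, has a
`k`-point over `w'`, and satisfies `T ⊆ B[1/c]` (`exists_model`). It remains to cut `B` down to a
curve through that point on which `c` does not vanish identically: localise at the point and divide
by a prime maximal among those avoiding `c`; by Krull's principal ideal theorem the result has
dimension at most one (`Ring.DimensionLEOne.of_forall_mem`). A valuation ring `O` dominating it has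
a principal maximal ideal and residue field `k`, because by the Krull–Akizuki argument
(`Ideal.finite_quotient_of_birational`) its quotients by nonzero elements are finite over `k`
(`exists_discrete_place`).

**From conflations to a degeneration.** Given a conflation `v → w ⊕ v → w'` with first map `α`,
replace `α` by the pencil `α - c • inr`. For all but finitely many `c` its image is complementary to
the summand `P`, so that its cokernel is isomorphic to `w`, and at `c = 0` the cokernel is `w'`.
Transporting all cokernels to `P` by means of a complement of the image of `α` describes the family
as a rational curve in `W(P)`, regular at `0`, whose general point lies in the orbit of `w`; hence
its value `w'` at `0` lies in the closure (`mem_closure_of_rational_curve`,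
`degenerates_of_conflation_left`). A conflation `w' → w ⊕ v → v` is treated dually, with kernels of
the pencil `β - c • snd` (`degenerates_of_conflation_right`).
-/

set_option linter.unusedSectionVars false

/-! ### Orders over a base field in dimension one -/

section CurveSelection

/-- In a Noetherian domain all of whose nonzero primes contain a fixed `f ≠ 0`, nonzero primes are
maximal: there are finitely many primes of height one, all minimal over `f`, so by prime avoidance
and Krull's principal ideal theorem there is nothing above them. -/
theorem Ring.DimensionLEOne.of_forall_mem {D : Type*} [CommRing D] [IsDomain D] [IsNoetherianRing D]
    {f : D} (hf : f ≠ 0) (h : ∀ p : Ideal D, p.IsPrime → p ≠ ⊥ → f ∈ p) :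
    Ring.DimensionLEOne D := by
  refine ⟨fun {p} hp0 hp => ?_⟩
  obtain ⟨m, hm, hpm⟩ := p.exists_le_maximal hp.ne_top
  obtain rfl | hlt := hpm.eq_or_lt
  · exact hm
  exfalso
  -- a prime of height at most one does not contain a nonzero prime strictly
  have height_one {x : D} {q q' : Ideal D} (hq : q ∈ (Ideal.span {x}).minimalPrimes)
      (hq' : q'.IsPrime) (h0 : q' ≠ ⊥) (hlt : q' < q) : False := by
    have := hq.1.1
    have h1 := Ideal.height_le_one_of_isPrincipal_of_mem_minimalPrimes _ q hq
    have h2 := (Ideal.height_le_iff (n := 1)).1 (by exact_mod_cast h1) q' hq' hlt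
    have h3 : q'.height = 0 := by simpa [Order.lt_one_iff] using h2
    exact h0 (Ideal.height_eq_zero_iff_eq_bot.1 h3)
  have hnot : ¬ ((m : Set D) ⊆
      ⋃ q ∈ (Ideal.span {f}).minimalPrimes, ((id q : Ideal D) : Set D)) := by
    intro hsub
    obtain ⟨q, hq, hmq⟩ := (Ideal.subset_union_prime_finite
      (Ideal.finite_minimalPrimes_of_isNoetherianRing D _) ⊥ ⊥ (fun q hq _ _ => hq.1.1)).1 hsub
    exact height_one hq hp hp0 (hlt.trans_le hmq)
  obtain ⟨x, hxm, hx⟩ := Set.not_subset.1 hnot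
  have hxm' : Ideal.span {x} ≤ m := (Ideal.span_singleton_le_iff_mem _).2 hxm
  obtain ⟨q, hq, -⟩ := Ideal.exists_minimalPrimes_le hxm'
  have hqp := hq.1.1
  have hxq : x ∈ q := hq.1.2 (Ideal.mem_span_singleton_self x)
  by_cases hq0 : q = ⊥
  · refine hx ?_
    rw [hq0, Ideal.mem_bot] at hxq
    have hfm : Ideal.span {f} ≤ m := (Ideal.span_singleton_le_iff_mem _).2 (hpm (h p hp hp0))
    obtain ⟨q', hq', -⟩ := Ideal.exists_minimalPrimes_le hfm
    exact Set.mem_biUnion hq' (by simp [hxq])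
  · have hfq : Ideal.span {f} ≤ q := (Ideal.span_singleton_le_iff_mem _).2 (h q hqp hq0)
    obtain ⟨q', hq', hle⟩ := Ideal.exists_minimalPrimes_le hfq
    obtain rfl | hlt' := hle.eq_or_lt
    · exact hx (Set.mem_biUnion hq' hxq)
    · refine height_one hq hq'.1.1 ?_ hlt'
      rintro rfl
      exact hf (by simpa using hq'.1.2 (Ideal.mem_span_singleton_self f))

/-- The base field enters through the residue fields: simple modules are of the form `D ⧸ m`. -/
theorem Module.Finite.of_isFiniteLength (k : Type*) {D : Type*} [Field k] [CommRing D] [Algebra k D]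
    (h : ∀ m : Ideal D, m.IsMaximal → Module.Finite k (D ⧸ m)) {M : Type*} [AddCommGroup M]
    [Module D M] (hM : IsFiniteLength D M) :
    ∀ [Module k M] [IsScalarTower k D M], Module.Finite k M := by
  induction hM with
  | of_subsingleton => intros; infer_instance
  | @of_simple_quotient M _ _ N _ _ ih =>
    intro _ _
    obtain ⟨m, hm, ⟨e⟩⟩ := isSimpleModule_iff_quot_maximal.1 ‹IsSimpleModule D (M ⧸ N)›
    have := h m hm
    have : Module.Finite k (M ⧸ N) := Module.Finite.equiv (e.restrictScalars k).symm
    have : Module.Finite k N := ih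
    have : Module.Finite k (N.restrictScalars k) := this
    have : Module.Finite k (M ⧸ N.restrictScalars k) := ‹Module.Finite k (M ⧸ N)›
    exact Module.Finite.of_submodule_quotient (N.restrictScalars k)

theorem Ideal.finite_quotient_of_dimensionLEOne (k : Type*) {D : Type*} [Field k] [CommRing D]
    [Algebra k D] [IsNoetherianRing D] [Ring.DimensionLEOne D]
    (h : ∀ m : Ideal D, m.IsMaximal → Module.Finite k (D ⧸ m)) {I : Ideal D} (hI : I ≠ ⊥) :
    Module.Finite k (D ⧸ I) := by
  have : Ring.KrullDimLE 0 (D ⧸ I) := by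
    refine Ring.KrullDimLE.mk₀ fun p hp => ?_
    have h1 : (p.comap (Ideal.Quotient.mk I)).IsMaximal := by
      refine Ring.DimensionLEOne.maximalOfPrime (fun h0 => hI ?_) (hp.comap _)
      rw [eq_bot_iff, ← h0]
      exact fun x hx => by simp [Ideal.Quotient.eq_zero_iff_mem.2 hx]
    have := Ideal.map_eq_top_or_isMaximal_of_surjective (Ideal.Quotient.mk I)
      Ideal.Quotient.mk_surjective h1
    rw [Ideal.map_comap_of_surjective (Ideal.Quotient.mk I) Ideal.Quotient.mk_surjective] at this
    exact this.resolve_left hp.ne_top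
  have hA : IsArtinianRing (D ⧸ I) :=
    isArtinianRing_iff_isNoetherianRing_krullDimLE_zero.2 ⟨inferInstance, this⟩
  have : IsArtinian D (D ⧸ I) :=
    isArtinian_of_surjective_algebraMap (R := D ⧸ I) Ideal.Quotient.mk_surjective
  exact Module.Finite.of_isFiniteLength k h (D := D)
    (isFiniteLength_iff_isNoetherian_isArtinian.2 ⟨inferInstance, this⟩)

/-- **Krull–Akizuki** over a base field: if every nonzero quotient of `D` is finite over `k`, then
so is `O / f O` for any `O` between `D` and its fraction field and any nonzero `f ∈ D`. The
dimension is at most `dim (D / f D)`: elements `l y` of `O` that are independent modulo `f` become,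
after multiplication by a common denominator `d`, independent elements of `I / f I` with `I = D ∩ d
O`, and `dim (I / f I) = dim (D / f D)`. -/
theorem Ideal.finite_quotient_of_birational (k : Type*) {D O : Type*} [Field k] [CommRing D]
    [Algebra k D] [IsDomain D] [CommRing O] [IsDomain O] [Algebra k O] [Algebra D O]
    [IsScalarTower k D O] (hDO : Function.Injective (algebraMap D O))
    (h : ∀ s : Finset O, ∃ d : D, d ≠ 0 ∧ ∀ o ∈ s, ∃ a : D, algebraMap D O a = algebraMap D O d * o)
    (hfin : ∀ I : Ideal D, I ≠ ⊥ → Module.Finite k (D ⧸ I)) {f : D} (hf : f ≠ 0) :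
    Module.Finite k (O ⧸ Ideal.span {algebraMap D O f}) := by
  classical
  have : Module.Finite k (D ⧸ Ideal.span {f}) := hfin _ (by simpa using hf)
  refine Module.rank_lt_aleph0_iff.1 ((rank_le (n := Module.finrank k (D ⧸ Ideal.span {f}))
    fun s hs => ?_).trans_lt Cardinal.natCast_lt_aleph0)
  let l : O ⧸ Ideal.span {algebraMap D O f} → O := Function.surjInv Ideal.Quotient.mk_surjective
  have hl : ∀ y, Ideal.Quotient.mk _ (l y) = y := Function.surjInv_eq _
  obtain ⟨d, hd, hs'⟩ := h (s.image l)
  have (y : s) : ∃ a : D, algebraMap D O a = algebraMap D O d * l y :=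
    hs' _ (Finset.mem_image_of_mem _ y.2)
  choose a ha using this
  let I : Ideal D := (Ideal.span {algebraMap D O d}).comap (algebraMap D O)
  have hI0 : I ≠ ⊥ := fun h0 => hd <| by
    rw [← Ideal.mem_bot, ← h0]; exact Ideal.mem_span_singleton_self _
  let J : Ideal D := Ideal.span {f} * I
  have hJ0 : J ≠ ⊥ := mul_ne_zero (by simpa using hf) hI0
  have := hfin I hI0
  have := hfin J hJ0
  have hmemJ : ∀ x, x ∈ J ↔ ∃ b ∈ I, f * b = x := fun x => Ideal.mem_span_singleton_mul
  have hJI : J ≤ I := Ideal.mul_le_right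
  have hJf : J ≤ Ideal.span {f} := Ideal.mul_le_left
  let α : (D ⧸ J) →ₗ[k] (D ⧸ I) := (Submodule.factor hJI).restrictScalars k
  have hα : ∀ x : D, α (Ideal.Quotient.mk J x) = Ideal.Quotient.mk I x := fun _ => rfl
  have hα' : Function.Surjective α := Submodule.factor_surjective hJI
  let β : (D ⧸ I) →ₗ[k] (D ⧸ J) := (Submodule.mapQ I J (LinearMap.mulLeft D f) fun b hb =>
    (hmemJ _).2 ⟨b, hb, rfl⟩).restrictScalars k
  have hβ : ∀ x : D, β (Ideal.Quotient.mk I x) = Ideal.Quotient.mk J (f * x) := fun _ => rfl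
  have hβ' : Function.Injective β := by
    rw [injective_iff_map_eq_zero]
    intro y hy
    obtain ⟨x, rfl⟩ := Ideal.Quotient.mk_surjective y
    rw [hβ, Ideal.Quotient.eq_zero_iff_mem, hmemJ] at hy
    obtain ⟨b, hb, hfb⟩ := hy
    rw [Ideal.Quotient.eq_zero_iff_mem, ← mul_left_cancel₀ hf hfb]
    exact hb
  let γ : (D ⧸ J) →ₗ[k] (D ⧸ Ideal.span {f}) := (Submodule.factor hJf).restrictScalars k
  have hγ : ∀ x : D, γ (Ideal.Quotient.mk J x) = Ideal.Quotient.mk _ x := fun _ => rfl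
  have hγ' : Function.Surjective γ := Submodule.factor_surjective hJf
  have hker : LinearMap.ker γ = LinearMap.range β := by
    ext y
    obtain ⟨x, rfl⟩ := Ideal.Quotient.mk_surjective y
    rw [LinearMap.mem_ker, hγ, Ideal.Quotient.eq_zero_iff_mem, Ideal.mem_span_singleton']
    constructor
    · rintro ⟨b, rfl⟩
      exact ⟨Ideal.Quotient.mk I b, by rw [hβ, mul_comm]⟩
    · rintro ⟨y, hy⟩
      obtain ⟨b, rfl⟩ := Ideal.Quotient.mk_surjective y
      rw [hβ, Ideal.Quotient.eq] at hy
      have := hJf hy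
      rw [Ideal.mem_span_singleton'] at this
      obtain ⟨c, hc⟩ := this
      exact ⟨b - c, by linear_combination -hc⟩
  -- `ker α = I / f I` has the dimension of `D / f D`: compare `D / f I` with `D / I` and `D / f D`
  have e1 := α.finrank_range_add_finrank_ker
  have e2 := γ.finrank_range_add_finrank_ker
  rw [LinearMap.range_eq_top.2 hα', finrank_top] at e1
  rw [LinearMap.range_eq_top.2 hγ', finrank_top, hker, LinearMap.finrank_range_of_inj hβ'] at e2
  have e3 : Module.finrank k (LinearMap.ker α) = Module.finrank k (D ⧸ Ideal.span {f}) := by omega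
  rw [← e3]
  let v : s → LinearMap.ker α := fun y => ⟨Ideal.Quotient.mk J (a y), by
    rw [LinearMap.mem_ker, hα, Ideal.Quotient.eq_zero_iff_mem, Ideal.mem_comap, ha]
    exact Ideal.mul_mem_right _ _ (Ideal.mem_span_singleton_self _)⟩
  have hv : LinearIndependent k v := by
    rw [Fintype.linearIndependent_iff] at hs ⊢
    intro c hc
    refine hs c ?_
    have hc' : Ideal.Quotient.mk J (∑ y, c y • a y) = 0 := by
      have := congrArg Subtype.val hc
      simpa [v, Algebra.smul_def] using this
    rw [Ideal.Quotient.eq_zero_iff_mem, hmemJ] at hc'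
    obtain ⟨b, hb, hfb⟩ := hc'
    obtain ⟨o, ho⟩ := Ideal.mem_span_singleton'.1 (Ideal.mem_comap.1 hb)
    have key : ∑ y, c y • l y = algebraMap D O f * o := by
      refine mul_left_cancel₀ ((map_ne_zero_iff _ hDO).2 hd) ?_
      have := congrArg (algebraMap D O) hfb
      rw [map_mul, ← ho, map_sum] at this
      rw [Finset.mul_sum]
      calc _ = ∑ y, algebraMap D O (c y • a y) := by
            refine Finset.sum_congr rfl fun y _ => ?_
            rw [show algebraMap D O (c y • a y) = c y • algebraMap D O (a y) from
              map_smul (IsScalarTower.toAlgHom k D O) _ _, ha, mul_smul_comm]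
        _ = _ := by rw [← this]; ring
    have : Ideal.Quotient.mk (Ideal.span {algebraMap D O f}) (∑ y, c y • l y) = 0 := by
      rw [key, Ideal.Quotient.eq_zero_iff_mem]
      exact Ideal.mul_mem_right _ _ (Ideal.mem_span_singleton_self _)
    rw [← this, map_sum]
    refine Finset.sum_congr rfl fun y _ => ?_
    conv_lhs => rw [← hl y]
    rfl
  have := hv.fintype_card_le_finrank
  simpa using this

end CurveSelection

/-! ### Discrete places of a Noetherian domain -/

section Place

variable {k : Type u} [Field k]

theorem AlgHom.ker_isMaximal_of_field {R : Type*} [CommRing R] [Algebra k R] (e : R →ₐ[k] k) :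
    (RingHom.ker e).IsMaximal :=
  RingHom.ker_isMaximal_of_surjective e fun c => ⟨algebraMap k R c, by simp⟩

theorem AlgHom.sub_algebraMap_mem_ker {R : Type*} [CommRing R] [Algebra k R] (e : R →ₐ[k] k)
    (x : R) : x - algebraMap k R (e x) ∈ RingHom.ker e := by
  simp [RingHom.mem_ker]

/-- A one-dimensional Noetherian local domain `D` with residue field `k` maps to a valuation ring
`O` of its fraction field, dominating it, whose maximal ideal is generated by one element `t` and
whose residue field is again `k`. By Krull–Akizuki `O / f O` is finite over `k`, which gives the
finite generation of the maximal ideal, the finiteness of the residue field, and the nilpotency of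
`t` modulo `f`. -/
theorem IsLocalRing.exists_discrete_place [IsAlgClosed k] {D : Type u} [CommRing D] [IsDomain D]
    [IsNoetherianRing D] [IsLocalRing D] [Algebra k D] [Ring.DimensionLEOne D]
    (e : D →ₐ[k] k) {f : D} (hf : f ≠ 0) (hef : e f = 0) :
    ∃ (O : Type u) (_ : CommRing O) (_ : IsDomain O) (_ : Algebra k O) (t : O) (ε : O →ₐ[k] k)
      (θ : D →ₐ[k] O), t ≠ 0 ∧ ε t = 0 ∧ (∀ b, ε b = 0 → t ∣ b) ∧ (∀ x, ε (θ x) = e x) ∧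
        ∃ n : ℕ, θ f ∣ t ^ n := by
  have hmax : RingHom.ker e = IsLocalRing.maximalIdeal D :=
    IsLocalRing.eq_maximalIdeal e.ker_isMaximal_of_field
  have hD (m : Ideal D) (hm : m.IsMaximal) : Module.Finite k (D ⧸ m) := by
    obtain rfl := (IsLocalRing.eq_maximalIdeal hm).trans hmax.symm
    refine Module.Finite.of_surjective (Algebra.linearMap k _) fun y => ?_
    obtain ⟨x, rfl⟩ := Ideal.Quotient.mk_surjective y
    exact ⟨e x, (Ideal.Quotient.eq.2 (e.sub_algebraMap_mem_ker x)).symm⟩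
  let K := FractionRing D
  obtain ⟨V, hV, hloc⟩ := IsLocalRing.exists_factor_valuationRing (algebraMap D K)
  let θ₀ : D →+* V := (algebraMap D K).codRestrict V.toSubring hV
  let _ : Algebra D V := θ₀.toAlgebra
  let _ : Algebra k V := (θ₀.comp (algebraMap k D)).toAlgebra
  have : IsScalarTower k D V := .of_algebraMap_eq fun _ => rfl
  let θ : D →ₐ[k] V := IsScalarTower.toAlgHom k D V
  have hcoe (x : D) : ((algebraMap D V x : V) : K) = algebraMap D K x := rfl
  have hinj : Function.Injective (algebraMap D V) := fun x y hxy =>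
    IsFractionRing.injective D K (congrArg Subtype.val hxy)
  have hθm {x : D} (hx : e x = 0) : θ x ∈ IsLocalRing.maximalIdeal V := by
    rw [IsLocalRing.mem_maximalIdeal, mem_nonunits_iff]
    intro hu
    have : x ∈ IsLocalRing.maximalIdeal D := hmax ▸ hx
    exact this (hloc.map_nonunit x hu)
  have hθf : θ f ≠ 0 := (map_ne_zero_iff _ hinj).2 hf
  have hfin : Module.Finite k (V ⧸ Ideal.span {θ f}) := by
    refine Ideal.finite_quotient_of_birational k (D := D) hinj (fun s => ?_)
      (fun I hI => Ideal.finite_quotient_of_dimensionLEOne k hD hI) hf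
    obtain ⟨d, hd⟩ := IsLocalization.exist_integer_multiples (nonZeroDivisors D) s
      (fun o => (o : K))
    refine ⟨d, nonZeroDivisors.coe_ne_zero d, fun o ho => ?_⟩
    obtain ⟨a, ha⟩ := hd o ho
    exact ⟨a, Subtype.ext (by rw [hcoe, ha, Algebra.smul_def]; rfl)⟩
  have hle : Ideal.span {θ f} ≤ IsLocalRing.maximalIdeal V :=
    (Ideal.span_singleton_le_iff_mem _).2 (hθm hef)
  -- the maximal ideal is principal
  have hfg : (IsLocalRing.maximalIdeal V).FG := by
    have : IsNoetherian V (V ⧸ Ideal.span {θ f}) := isNoetherian_of_tower k inferInstance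
    refine Submodule.fg_of_fg_map_of_fg_inf_ker (Submodule.mkQ (Ideal.span {θ f}))
      (IsNoetherian.noetherian _) ?_
    rw [Submodule.ker_mkQ, inf_eq_right.2 hle]
    exact Submodule.fg_span_singleton _
  obtain ⟨t, ht⟩ := (IsBezout.isPrincipal_of_FG _ hfg).principal
  have htm : t ∈ IsLocalRing.maximalIdeal V := ht ▸ Submodule.mem_span_singleton_self t
  -- the residue field is `k`
  have : Module.Finite k (V ⧸ IsLocalRing.maximalIdeal V) :=
    Module.Finite.of_surjective ((Submodule.factor hle).restrictScalars k)
      (Submodule.factor_surjective hle)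
  have : Algebra.IsIntegral k (V ⧸ IsLocalRing.maximalIdeal V) := Algebra.IsIntegral.of_finite k _
  have hbij : Function.Bijective (algebraMap k (V ⧸ IsLocalRing.maximalIdeal V)) :=
    IsAlgClosed.algebraMap_bijective_of_isIntegral
  let ρ : k ≃ₐ[k] (V ⧸ IsLocalRing.maximalIdeal V) := AlgEquiv.ofBijective (Algebra.ofId k _) hbij
  let ε : V →ₐ[k] k := ρ.symm.toAlgHom.comp (Ideal.Quotient.mkₐ k _)
  have hε (b : V) : ε b = 0 ↔ b ∈ IsLocalRing.maximalIdeal V := by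
    rw [← Ideal.Quotient.eq_zero_iff_mem]
    exact map_eq_zero_iff ρ.symm ρ.symm.injective
  refine ⟨V, inferInstance, inferInstance, inferInstance, t, ε, θ, ?_, (hε t).2 htm,
    fun b hb => ?_, fun x => ?_, ?_⟩
  · rintro rfl
    have := hθm hef
    rw [ht] at this
    exact hθf (by simpa using this)
  · rw [hε, ht] at hb
    exact Ideal.mem_span_singleton.1 hb
  · have := (hε _).2 (hθm (e.sub_algebraMap_mem_ker x))
    rwa [map_sub, map_sub, AlgHom.commutes, AlgHom.commutes, sub_eq_zero] at this
  · have hne : Ideal.span {θ f} ≠ ⊤ := fun h0 =>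
      (IsLocalRing.maximalIdeal.isMaximal V).ne_top (top_le_iff.1 (h0 ▸ hle))
    have : Nontrivial (V ⧸ Ideal.span {θ f}) := Ideal.Quotient.nontrivial_iff.2 hne
    have : IsLocalRing (V ⧸ Ideal.span {θ f}) :=
      IsLocalRing.of_surjective' (Ideal.Quotient.mk _) Ideal.Quotient.mk_surjective
    have : IsArtinianRing (V ⧸ Ideal.span {θ f}) := IsArtinianRing.of_finite k _
    obtain ⟨n, hn⟩ := IsArtinianRing.isNilpotent_jacobson_bot (R := V ⧸ Ideal.span {θ f})
    refine ⟨n, Ideal.mem_span_singleton.1 ?_⟩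
    rw [← Ideal.Quotient.eq_zero_iff_mem, map_pow, ← Ideal.mem_bot, ← Ideal.zero_eq_bot, ← hn]
    refine Ideal.pow_mem_pow ?_ n
    rw [IsLocalRing.jacobson_eq_maximalIdeal _ bot_ne_top, IsLocalRing.mem_maximalIdeal,
      mem_nonunits_iff]
    intro hu
    obtain ⟨y, hy⟩ := hu.exists_right_inv
    obtain ⟨s, rfl⟩ := Ideal.Quotient.mk_surjective y
    rw [← map_mul, ← map_one (Ideal.Quotient.mk _), Ideal.Quotient.eq] at hy
    refine (Ideal.ne_top_iff_one _).1 (IsLocalRing.maximalIdeal.isMaximal V).ne_top ?_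
    rw [← sub_sub_cancel (t * s) 1]
    exact sub_mem (Ideal.mul_mem_right _ _ htm) (hle hy)

/-- A curve through a `k`-point `e` of the spectrum of a Noetherian domain `B` that is not contained
in the zero set of a given `f ≠ 0` through the point, in the form of a homomorphism `θ` to a ring
`O` with a principal augmentation ideal `(t)`. Passing to a quotient by a prime maximal among those
avoiding `f` makes the dimension at most one. -/
theorem exists_discrete_place [IsAlgClosed k] {B : Type u} [CommRing B] [IsDomain B]
    [IsNoetherianRing B] [Algebra k B] (e : B →ₐ[k] k) {f : B} (hf : f ≠ 0) (hef : e f = 0) :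
    ∃ (O : Type u) (_ : CommRing O) (_ : IsDomain O) (_ : Algebra k O) (t : O) (ε : O →ₐ[k] k)
      (θ : B →ₐ[k] O), t ≠ 0 ∧ ε t = 0 ∧ (∀ b, ε b = 0 → t ∣ b) ∧ (∀ x, ε (θ x) = e x) ∧
        ∃ n : ℕ, θ f ∣ t ^ n := by
  have := e.ker_isMaximal_of_field
  have hp : (RingHom.ker e).IsPrime := this.isPrime
  let L := Localization.AtPrime (RingHom.ker e)
  have : IsNoetherianRing L := IsLocalization.isNoetherianRing (RingHom.ker e).primeCompl L ‹_›
  have : IsDomain L :=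
    IsLocalization.isDomain_localization (RingHom.ker e).primeCompl_le_nonZeroDivisors
  let eL : L →ₐ[k] k := IsLocalization.liftAlgHom (M := (RingHom.ker e).primeCompl) (f := e)
    fun y => isUnit_iff_ne_zero.2 y.2
  have heL (x : B) : eL (algebraMap B L x) = e x := IsLocalization.lift_eq _ x
  have hinj : Function.Injective (algebraMap B L) :=
    IsLocalization.injective L (RingHom.ker e).primeCompl_le_nonZeroDivisors
  have hfL : algebraMap B L f ≠ 0 := (map_ne_zero_iff _ hinj).2 hf
  -- a prime maximal among those not containing `f`
  obtain ⟨q, ⟨hq, hfq⟩, hqmax⟩ := set_has_maximal_iff_noetherian.2 ‹IsNoetherianRing L›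
    {q : Ideal L | q.IsPrime ∧ algebraMap B L f ∉ q} ⟨⊥, Ideal.isPrime_bot, hfL⟩
  have hqe (x : L) (hx : x ∈ q) : eL x = 0 := by
    have h1 : q ≤ IsLocalRing.maximalIdeal L := IsLocalRing.le_maximalIdeal hq.ne_top
    rw [← IsLocalRing.eq_maximalIdeal eL.ker_isMaximal_of_field] at h1
    exact h1 hx
  let eD : (L ⧸ q) →ₐ[k] k := Ideal.Quotient.liftₐ q eL hqe
  have : IsLocalRing (L ⧸ q) :=
    IsLocalRing.of_surjective' (Ideal.Quotient.mk q) Ideal.Quotient.mk_surjective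
  have hfD : Ideal.Quotient.mk q (algebraMap B L f) ≠ 0 := by
    rwa [Ne, Ideal.Quotient.eq_zero_iff_mem]
  have : Ring.DimensionLEOne (L ⧸ q) := by
    refine .of_forall_mem hfD fun p hp hp0 => ?_
    by_contra hfp
    refine hqmax (p.comap (Ideal.Quotient.mk q)) ⟨hp.comap _, hfp⟩
      (lt_of_le_of_ne (fun x hx => ?_) fun h => hp0 ?_)
    · rw [Ideal.mem_comap, Ideal.Quotient.eq_zero_iff_mem.2 hx]
      exact zero_mem p
    · rw [← Ideal.map_comap_of_surjective (Ideal.Quotient.mk q) Ideal.Quotient.mk_surjective p, ← h,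
        Ideal.map_quotient_self]
  obtain ⟨O, _, _, _, t, ε, θ, h1, h2, h3, h4, h5⟩ := IsLocalRing.exists_discrete_place eD hfD
    ((heL f).trans hef)
  refine ⟨O, _, inferInstance, _, t, ε,
    θ.comp ((Ideal.Quotient.mkₐ k q).comp (Algebra.algHom k B L)),
    h1, h2, h3, fun x => (h4 _).trans (heL x), h5⟩

end Place

/-! ### Affine models dominating a point of an image closure -/

section Model

open scoped nonZeroDivisors

variable {k : Type u} [Field k]

/-- The weak Nullstellensatz for a proper ideal of a finitely generated algebra. -/
theorem exists_algHom_of_finiteType [IsAlgClosed k] {B : Type*} [CommRing B] [Algebra k B]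
    [Algebra.FiniteType k B] {I : Ideal B} (hI : I ≠ ⊤) : ∃ e : B →ₐ[k] k, ∀ x ∈ I, e x = 0 := by
  obtain ⟨m, hm, hIm⟩ := I.exists_le_maximal hI
  let _ := Ideal.Quotient.field m
  have : Algebra.FiniteType k (B ⧸ m) := .of_surjective (Ideal.Quotient.mkₐ k m)
    Ideal.Quotient.mk_surjective
  have : Module.Finite k (B ⧸ m) := finite_of_finite_type_of_isJacobsonRing k _
  have : Algebra.IsIntegral k (B ⧸ m) := Algebra.IsIntegral.of_finite k _
  let ρ : k ≃ₐ[k] (B ⧸ m) := AlgEquiv.ofBijective (Algebra.ofId k _)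
    IsAlgClosed.algebraMap_bijective_of_isIntegral
  refine ⟨ρ.symm.toAlgHom.comp (Ideal.Quotient.mkₐ k _), fun x hx => ?_⟩
  exact (map_eq_zero_iff ρ.symm ρ.symm.injective).2 (Ideal.Quotient.eq_zero_iff_mem.2 (hIm hx))

/-- Let `y` be finitely many elements of a finitely generated domain `T`, that is, a morphism from
the affine variety of `T` to an affine space, and let `a` be a point of the closure of its image.
Some finitely generated subalgebra `B` of the fraction field contains the `y j`, has a `k`-point `e`
over `a`, and agrees with `T` up to inverting one element `c ≠ 0`. It is found inside a valuation
ring dominating the point `a`. -/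
theorem exists_model [IsAlgClosed k] {T : Type u} [CommRing T] [IsDomain T] [Algebra k T]
    [hT : Algebra.FiniteType k T] {σ : Type*} [Finite σ] (y : σ → T) (a : σ → k)
    (h : ∀ F : MvPolynomial σ k, MvPolynomial.aeval y F = 0 → MvPolynomial.eval a F = 0) :
    ∃ (B : Subalgebra k (FractionRing T)) (c : B) (e : B →ₐ[k] k), Algebra.FiniteType k B ∧ c ≠ 0 ∧
      (∀ z : T, ∃ n : ℕ, (c : FractionRing T) ^ n * algebraMap T _ z ∈ B) ∧
      ∀ j, ∃ b : B, (b : FractionRing T) = algebraMap T _ (y j) ∧ e b = a j := by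
  classical
  let K := FractionRing T
  let y' : σ → K := fun j => algebraMap T K (y j)
  have hy' (F : MvPolynomial σ k) (hF : MvPolynomial.aeval y' F = 0) :
      MvPolynomial.eval a F = 0 := by
    refine h F (IsFractionRing.injective T K ?_)
    rw [map_zero, ← hF]
    exact (MvPolynomial.aeval_algebraMap_apply K y F).symm
  -- a valuation ring of `K` dominating the point `a` of the closure
  let A : Subring K := (MvPolynomial.aeval (R := k) y').range.toSubring
  let I : Ideal A := Ideal.map
    ((MvPolynomial.aeval (R := k) y').rangeRestrict : MvPolynomial σ k →+* A)
    (RingHom.ker (MvPolynomial.eval a))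
  have hsurj : Function.Surjective
      ((MvPolynomial.aeval (R := k) y').rangeRestrict : MvPolynomial σ k →+* A) :=
    AlgHom.rangeRestrict_surjective _
  have hI : I ≠ ⊤ := by
    rw [Ideal.ne_top_iff_one, Ideal.mem_map_iff_of_surjective _ hsurj]
    rintro ⟨F, hF, hF1⟩
    have h1 : MvPolynomial.aeval y' F = 1 := congrArg Subtype.val hF1
    have := hy' (F - 1) (by rw [map_sub, h1, map_one, sub_self])
    rw [map_sub, map_one, (RingHom.mem_ker).1 hF] at this
    simp at this
  obtain ⟨V, hAV, hIV⟩ := Ideal.image_subset_nonunits_valuationSubring I hI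
  have hkV (r : k) : algebraMap k K r ∈ V := hAV ⟨MvPolynomial.C r, by simp⟩
  have hyV (j : σ) : y' j ∈ V := hAV ⟨MvPolynomial.X j, by simp⟩
  have hyI (j : σ) : y' j - algebraMap k K (a j) ∈ V.nonunits := by
    refine hIV ⟨((MvPolynomial.aeval (R := k) y').rangeRestrict : MvPolynomial σ k →+* A)
      (MvPolynomial.X j - MvPolynomial.C (a j)), Ideal.mem_map_of_mem _ ?_, ?_⟩
    · simp [RingHom.mem_ker]
    · change MvPolynomial.aeval y' _ = _
      simp
  -- a common denominator of the generators of `T`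
  obtain ⟨s, hs⟩ := hT.out
  obtain ⟨c, hc⟩ := IsLocalization.exist_integer_multiples V⁰ (S := K) s (algebraMap T K)
  have hc0 : ((c : V) : K) ≠ 0 := fun h0 => nonZeroDivisors.coe_ne_zero c (Subtype.ext h0)
  have hcV (z : T) (hz : z ∈ s) : (c : K) * algebraMap T K z ∈ V := by
    obtain ⟨x, hx⟩ := hc z hz
    have : (x : K) = (c : K) * algebraMap T K z := hx.trans (Algebra.smul_def _ _)
    exact this ▸ x.2
  let G : Set K := insert (c : K) (Set.range y' ∪ (fun z => (c : K) * algebraMap T K z) '' s)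
  have hG : G.Finite := ((Set.finite_range y').union (s.finite_toSet.image _)).insert _
  let B : Subalgebra k K := Algebra.adjoin k G
  have hBV (x : K) (hx : x ∈ B) : x ∈ V := by
    induction hx using Algebra.adjoin_induction with
    | mem x hx =>
      obtain rfl | ⟨j, rfl⟩ | ⟨z, hz, rfl⟩ := hx
      · exact c.1.2
      · exact hyV j
      · exact hcV z hz
    | algebraMap r => exact hkV r
    | add x y _ _ hx hy => exact add_mem hx hy
    | mul x y _ _ hx hy => exact mul_mem hx hy
  have hGB (x : K) (hx : x ∈ G) : x ∈ B := Algebra.subset_adjoin hx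
  have hcB : (c : K) ∈ B := hGB _ (Set.mem_insert _ _)
  have hyB (j : σ) : y' j ∈ B := hGB _ (Or.inr (Or.inl ⟨j, rfl⟩))
  have : Algebra.FiniteType k B :=
    (Subalgebra.fg_iff_finiteType B).1 (Subalgebra.fg_def.2 ⟨G, hG, rfl⟩)
  let ι : B →+* V := B.val.toRingHom.codRestrict V.toSubring fun x => hBV x x.2
  have hI' : (IsLocalRing.maximalIdeal V).comap ι ≠ ⊤ :=
    Ideal.comap_ne_top _ (IsLocalRing.maximalIdeal.isMaximal V).ne_top
  obtain ⟨e, he⟩ := exists_algHom_of_finiteType (k := k) hI'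
  refine ⟨B, ⟨c, hcB⟩, e, this, fun h0 => hc0 (congrArg Subtype.val h0), fun z => ?_, fun j => ?_⟩
  · have hz : z ∈ Algebra.adjoin k (s : Set T) := hs ▸ Algebra.mem_top
    induction hz using Algebra.adjoin_induction with
    | mem z hz => exact ⟨1, by rw [pow_one]; exact hGB _ (Or.inr (Or.inr ⟨z, hz, rfl⟩))⟩
    | algebraMap r => exact ⟨0, by
        rw [pow_zero, one_mul, ← IsScalarTower.algebraMap_apply]; exact B.algebraMap_mem r⟩
    | add x y _ _ hx hy =>
      obtain ⟨n, hn⟩ := hx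
      obtain ⟨m, hm⟩ := hy
      refine ⟨n + m, ?_⟩
      have : (c : K) ^ (n + m) * algebraMap T K (x + y) =
          (c : K) ^ m * ((c : K) ^ n * algebraMap T K x) +
            (c : K) ^ n * ((c : K) ^ m * algebraMap T K y) := by rw [map_add]; ring
      exact this ▸ add_mem (mul_mem (pow_mem hcB _) hn) (mul_mem (pow_mem hcB _) hm)
    | mul x y _ _ hx hy =>
      obtain ⟨n, hn⟩ := hx
      obtain ⟨m, hm⟩ := hy
      refine ⟨n + m, ?_⟩
      have : (c : K) ^ (n + m) * algebraMap T K (x * y) =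
        ((c : K) ^ n * algebraMap T K x) * ((c : K) ^ m * algebraMap T K y) := by rw [map_mul]; ring
      exact this ▸ mul_mem hn hm
  · refine ⟨⟨y' j, hyB j⟩, rfl, ?_⟩
    have h1 := he (⟨y' j, hyB j⟩ - algebraMap k B (a j)) (by
      rw [Ideal.mem_comap]
      exact ValuationSubring.coe_mem_nonunits_iff.1 (hyI j))
    rwa [map_sub, AlgHom.commutes, sub_eq_zero] at h1

end Model

namespace BimoduleEl

/-! ### Intertwining maps and cokernels -/

section Intertwine

variable {k A W : Type u} [Field k] [Ring A] [Algebra k A]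
  [AddCommGroup W] [Module k W] [Module A W] [Module Aᵐᵒᵖ W]
  [IsScalarTower k A W] [IsScalarTower k Aᵐᵒᵖ W] [SMulCommClass A Aᵐᵒᵖ W]
  {P P' P'' : Type u}
  [AddCommGroup P] [Module k P] [Module A P] [IsScalarTower k A P]
  [AddCommGroup P'] [Module k P'] [Module A P'] [IsScalarTower k A P']
  [AddCommGroup P''] [Module k P''] [Module A P''] [IsScalarTower k A P'']

theorem bmap_mk (α : P →ₗ[A] P') (w : W) (p : P) :
    bmap k A W α (Submodule.Quotient.mk (w ⊗ₜ[k] p)) = Submodule.Quotient.mk (w ⊗ₜ[k] (α p)) :=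
  rfl

theorem bmap_add (α β : P →ₗ[A] P') : bmap k A W (α + β) = bmap k A W α + bmap k A W β :=
  bmap_ext k A W fun w p => by
    simp only [bmap_mk, LinearMap.add_apply, TensorProduct.tmul_add, Submodule.Quotient.mk_add]

theorem bmap_smul (c : k) (α : P →ₗ[A] P') : bmap k A W (c • α) = c • bmap k A W α :=
  bmap_ext k A W fun w p => by
    simp only [bmap_mk, LinearMap.smul_apply, TensorProduct.tmul_smul, Submodule.Quotient.mk_smul]

theorem bmap_zero : bmap k A W (0 : P →ₗ[A] P') = 0 :=
  bmap_ext k A W fun w p => by simp [bmap_mk]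

theorem bmap_bmap (β : P' →ₗ[A] P'') (α : P →ₗ[A] P') (y : BTensor k A W P) :
    bmap k A W β (bmap k A W α y) = bmap k A W (β ∘ₗ α) y := by
  rw [bmap_comp]; rfl

/-- `α : P → P'` satisfies `(1 ⊗ α) w = w' α`. This is the defining condition of a morphism of
`W-el`, without any finiteness or projectivity assumption on `P` and `P'`. -/
def Intertwines (w : Elts k A W P) (w' : Elts k A W P') (α : P →ₗ[A] P') : Prop :=
  bmap k A W α ∘ₗ w = w' ∘ₗ α

namespace Intertwines

variable {w : Elts k A W P} {w' : Elts k A W P'} {w'' : Elts k A W P''}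

theorem apply {α : P →ₗ[A] P'} (h : Intertwines w w' α) (x : P) :
    bmap k A W α (w x) = w' (α x) := LinearMap.congr_fun h x

theorem id : Intertwines w w LinearMap.id := by
  rw [Intertwines, bmap_id]; rfl

theorem comp {β : P' →ₗ[A] P''} {α : P →ₗ[A] P'} (hβ : Intertwines w' w'' β)
    (hα : Intertwines w w' α) : Intertwines w w'' (β ∘ₗ α) :=
  LinearMap.ext fun x => by simp [← bmap_bmap, hα.apply, hβ.apply]

theorem add {α β : P →ₗ[A] P'} (hα : Intertwines w w' α) (hβ : Intertwines w w' β) :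
    Intertwines w w' (α + β) :=
  LinearMap.ext fun x => by simp [bmap_add, hα.apply, hβ.apply]

theorem smul {α : P →ₗ[A] P'} (hα : Intertwines w w' α) (c : k) : Intertwines w w' (c • α) :=
  LinearMap.ext fun x => by
    rw [LinearMap.comp_apply, bmap_smul, LinearMap.smul_apply, hα.apply, LinearMap.comp_apply,
      LinearMap.smul_apply, LinearMap.map_smul_of_tower]

theorem sub {α β : P →ₗ[A] P'} (hα : Intertwines w w' α) (hβ : Intertwines w w' β) :
    Intertwines w w' (α - β) := by
  have := hα.add (hβ.smul (-1))
  rwa [neg_one_smul, ← sub_eq_add_neg] at this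

theorem pow {w : Elts k A W P} {α : Module.End A P} (hα : Intertwines w w α) (n : ℕ) :
    Intertwines w w (α ^ n) := by
  induction n with
  | zero => exact Intertwines.id
  | succ n ih => rw [pow_succ]; exact ih.comp hα

theorem fst : Intertwines (sumElt k A W w w') w (LinearMap.fst A P P') :=
  LinearMap.ext fun x => by
    simp [sumElt, bmap_bmap, LinearMap.fst_comp_inl, LinearMap.fst_comp_inr, bmap_id, bmap_zero]

theorem snd : Intertwines (sumElt k A W w w') w' (LinearMap.snd A P P') :=
  LinearMap.ext fun x => by
    simp [sumElt, bmap_bmap, LinearMap.snd_comp_inl, LinearMap.snd_comp_inr, bmap_id, bmap_zero]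

theorem inl : Intertwines w (sumElt k A W w w') (LinearMap.inl A P P') :=
  LinearMap.ext fun x => by simp [sumElt]

theorem inr : Intertwines w' (sumElt k A W w w') (LinearMap.inr A P P') :=
  LinearMap.ext fun x => by simp [sumElt]

theorem prod {α : P →ₗ[A] P'} {β : P →ₗ[A] P''} (hα : Intertwines w w' α)
    (hβ : Intertwines w w'' β) : Intertwines w (sumElt k A W w' w'') (α.prod β) := by
  have := (inl (w' := w'').comp hα).add (inr (w := w').comp hβ)
  convert this using 1
  ext x <;> simp

theorem coprod {α : P' →ₗ[A] P} {β : P'' →ₗ[A] P} (hα : Intertwines w' w α)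
    (hβ : Intertwines w'' w β) : Intertwines (sumElt k A W w' w'') w (α.coprod β) := by
  exact (hα.comp (fst (w' := w''))).add (hβ.comp (snd (w := w')))

/-- Intertwining may be checked after composing with a surjection. -/
theorem of_comp_surjective {β : P' →ₗ[A] P''} {α : P →ₗ[A] P'} (hα : Intertwines w w' α)
    (h : Intertwines w w'' (β ∘ₗ α)) (hs : Function.Surjective α) : Intertwines w' w'' β := by
  refine LinearMap.ext fun y => ?_
  obtain ⟨x, rfl⟩ := hs y
  rw [LinearMap.comp_apply, ← hα.apply, bmap_bmap, h.apply]; rfl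

end Intertwines

section Coker

variable {w : Elts k A W P} {w' : Elts k A W P'} {g : P →ₗ[A] P'}

/-- The element of `W(P' / g P)` induced by `w' ∈ W(P')`, for `g` intertwining some `w ∈ W(P)`
with `w'`. No projectivity of the cokernel is required. -/
def cokerElt (hg : Intertwines w w' g) : Elts k A W (P' ⧸ LinearMap.range g) :=
  (LinearMap.range g).liftQ (bmap k A W (LinearMap.range g).mkQ ∘ₗ w') (by
    rintro _ ⟨x, rfl⟩
    rw [LinearMap.mem_ker, LinearMap.comp_apply, ← hg.apply, bmap_bmap, LinearMap.range_mkQ_comp,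
      bmap_zero, LinearMap.zero_apply])

theorem Intertwines.mkQ (hg : Intertwines w w' g) :
    Intertwines w' (cokerElt hg) (LinearMap.range g).mkQ :=
  LinearMap.ext fun _ => rfl

theorem Intertwines.of_mkQ (hg : Intertwines w w' g) {w'' : Elts k A W P''}
    {β : (P' ⧸ LinearMap.range g) →ₗ[A] P''}
    (h : Intertwines w' w'' (β ∘ₗ (LinearMap.range g).mkQ)) : Intertwines (cokerElt hg) w'' β :=
  hg.mkQ.of_comp_surjective h (Submodule.mkQ_surjective _)

end Coker

end Intertwine

/-! ### Conflations from a lattice -/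

section Lattice

variable {k A W : Type u} [Field k] [Ring A] [Algebra k A]
  [AddCommGroup W] [Module k W] [Module A W] [Module Aᵐᵒᵖ W]
  [IsScalarTower k A W] [IsScalarTower k Aᵐᵒᵖ W] [SMulCommClass A Aᵐᵒᵖ W]
  {P Q : Type u}
  [AddCommGroup P] [Module k P] [Module A P] [IsScalarTower k A P]
  [AddCommGroup Q] [Module k Q] [Module A Q] [IsScalarTower k A Q]

/-- A family of elements over a ring of parameters with a uniformizer `t`, which joins `w` to `w'`,
recorded through the module `Q` of the family alone: the parameter ring enters only by the
endomorphism `t` of `Q`. The quotient `Q / t Q` is identified with `P` by `π`, with section `c`. The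
constant family `wQ` has the fibre `w`, and the family `uQ` has the fibre `w'`; they become
isomorphic after inverting `t`, by `g` and `h = t ^ N g⁻¹`. -/
structure LatticeData (w w' : Elts k A W P) (Q : Type u)
    [AddCommGroup Q] [Module k Q] [Module A Q] [IsScalarTower k A Q] where
  /-- The constant family with fibre `w`. -/
  wQ : Elts k A W Q
  /-- The family with special fibre `w'`. -/
  uQ : Elts k A W Q
  /-- Multiplication by the uniformizer. -/
  t : Module.End A Q
  /-- Subtraction of the constant term, followed by division by `t`. -/
  d : Module.End A Q
  /-- The generic isomorphism from `wQ` to `uQ`. -/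
  g : Module.End A Q
  /-- The generic inverse of `g`, cleared of denominators. -/
  h : Module.End A Q
  /-- The inclusion of constant sections. -/
  c : P →ₗ[A] Q
  /-- Reduction modulo `t`. -/
  π : Q →ₗ[A] P
  /-- The order of the denominator of `g⁻¹`. -/
  N : ℕ
  dt : ∀ x, d (t x) = x
  πc : ∀ p, π (c p) = p
  πt : ∀ x, π (t x) = 0
  cπ : ∀ x, c (π x) + t (d x) = x
  gh : ∀ x, g (h x) = (t ^ N) x
  hg : ∀ x, h (g x) = (t ^ N) x
  gt : ∀ x, g (t x) = t (g x)
  ht : ∀ x, h (t x) = t (h x)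
  g_intertwines : Intertwines wQ uQ g
  h_intertwines : Intertwines uQ wQ h
  t_wQ : Intertwines wQ wQ t
  t_uQ : Intertwines uQ uQ t
  d_wQ : Intertwines wQ wQ d
  c_wQ : Intertwines w wQ c
  π_wQ : Intertwines wQ w π
  π_uQ : Intertwines uQ w' π

namespace LatticeData

variable {w w' : Elts k A W P} (D : LatticeData w w' Q)

theorem d_pow_t_pow (n : ℕ) (x : Q) : (D.d ^ n) ((D.t ^ n) x) = x := by
  induction n generalizing x with
  | zero => rfl
  | succ n ih =>
    rw [pow_succ, pow_succ', Module.End.mul_apply, Module.End.mul_apply, D.dt, ih]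

theorem t_t_pow (n : ℕ) (x : Q) : D.t ((D.t ^ n) x) = (D.t ^ n) (D.t x) := by
  rw [← Module.End.mul_apply, ← Module.End.mul_apply, ← pow_succ, pow_succ']

theorem t_injective : Function.Injective D.t :=
  Function.LeftInverse.injective D.dt

theorem h_injective : Function.Injective D.h := fun x y hxy => by
  rw [← D.d_pow_t_pow D.N x, ← D.gh, hxy, D.gh, D.d_pow_t_pow]

theorem sub_cπ (x : Q) : x - D.c (D.π x) = D.t (D.d x) :=
  sub_eq_of_eq_add' (D.cπ x).symm

theorem dc (p : P) : D.d (D.c p) = 0 := by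
  have := D.cπ (D.c p)
  rw [D.πc, add_eq_left] at this
  exact D.t_injective (by rw [this, map_zero])

/-- A submodule of `Q` containing a power `t ^ n Q` has a finitely generated quotient, because
`Q = cP + t cP + ⋯ + t ^ (n - 1) cP + t ^ n Q`. -/
theorem finite_quotient [Module.Finite A P] (S : Submodule A Q) (n : ℕ)
    (hS : LinearMap.range (D.t ^ n) ≤ S) : Module.Finite A (Q ⧸ S) := by
  have key : ∀ n : ℕ, ∃ F : Submodule A Q, F.FG ∧ F ⊔ LinearMap.range (D.t ^ n) = ⊤ := by
    intro n
    induction n with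
    | zero => exact ⟨⊥, Submodule.fg_bot, by simp [Module.End.one_eq_id]⟩
    | succ n ih =>
      obtain ⟨F, hF, hFt⟩ := ih
      refine ⟨F ⊔ LinearMap.range ((D.t ^ n) ∘ₗ D.c), hF.sup ?_, ?_⟩
      · rw [LinearMap.range_eq_map]; exact Module.Finite.fg_top.map _
      · rw [eq_top_iff, ← hFt, sup_le_iff]
        refine ⟨le_sup_of_le_left le_sup_left, ?_⟩
        rintro _ ⟨x, rfl⟩
        rw [← D.cπ x, map_add, ← D.t_t_pow, ← Module.End.mul_apply D.t, ← pow_succ']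
        exact add_mem (Submodule.mem_sup_left (Submodule.mem_sup_right ⟨_, rfl⟩))
          (Submodule.mem_sup_right ⟨_, rfl⟩)
  obtain ⟨F, hF, hFt⟩ := key n
  refine ⟨?_⟩
  have : F.map S.mkQ = ⊤ := by
    rw [Submodule.map_mkQ_eq_top, sup_comm, eq_top_iff, ← hFt]
    exact sup_le_sup_left hS F
  exact this ▸ hF.map _

theorem finite_coker_g [Module.Finite A P] : Module.Finite A (Q ⧸ LinearMap.range D.g) :=
  D.finite_quotient _ D.N (by rintro _ ⟨x, rfl⟩; exact ⟨D.h x, D.gh x⟩)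

theorem finite_coker_h [Module.Finite A P] : Module.Finite A (Q ⧸ LinearMap.range D.h) :=
  D.finite_quotient _ D.N (by rintro _ ⟨x, rfl⟩; exact ⟨D.g x, D.hg x⟩)

theorem _root_.Module.Projective.quotient_range_of_leftInverse {R M N : Type*} [Ring R]
    [AddCommGroup M] [Module R M] [AddCommGroup N] [Module R N] [Module.Projective R M]
    {g : N →ₗ[R] M} {r : M →ₗ[R] N} (h : r ∘ₗ g = LinearMap.id) :
    Module.Projective R (M ⧸ LinearMap.range g) := by
  have hr : ∀ x, r (g x) = x := LinearMap.congr_fun h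
  refine Module.Projective.of_split
    ((LinearMap.range g).liftQ (LinearMap.id - g ∘ₗ r) ?_) (LinearMap.range g).mkQ ?_
  · rintro _ ⟨x, rfl⟩
    simp [hr]
  · ext x
    simp [Submodule.Quotient.mk_sub]

/-- The map `d ^ N h` is a retraction of `g`, which splits the cokernel off `Q`. -/
theorem projective_coker_g [Module.Projective A Q] :
    Module.Projective A (Q ⧸ LinearMap.range D.g) :=
  Module.Projective.quotient_range_of_leftInverse (r := (D.d ^ D.N) ∘ₗ D.h)
    (LinearMap.ext fun x => by simp [D.hg, D.d_pow_t_pow])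

theorem projective_coker_h [Module.Projective A Q] :
    Module.Projective A (Q ⧸ LinearMap.range D.h) :=
  Module.Projective.quotient_range_of_leftInverse (r := (D.d ^ D.N) ∘ₗ D.g)
    (LinearMap.ext fun x => by simp [D.gh, D.d_pow_t_pow])

/-- The coefficient of `t ^ N` in the expansion of `h x` by powers of `t`; in other words, the
constant term of `g⁻¹ x`. -/
def coeff : Q →ₗ[A] P := D.π ∘ₗ (D.d ^ D.N) ∘ₗ D.h

theorem coeff_g (x : Q) : D.coeff (D.g x) = D.π x := by
  simp [coeff, D.hg, D.d_pow_t_pow]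

theorem coeff_intertwines : Intertwines D.uQ w D.coeff :=
  D.π_wQ.comp ((D.d_wQ.pow _).comp D.h_intertwines)

/-- With `v` the element induced by `uQ` on `Q / g Q`, the conflation is `x ↦ (coeff (t x), t x)`
followed by `(p, x) ↦ π (g c p + x - g c (coeff x))`. The second map is chosen so as to vanish on `g
Q` in its second variable, since `coeff (g x)` is the constant term of `x`. -/
theorem exists_conflation_left (D : LatticeData w w' Q) [Module.Finite A P] [Module.Projective A P]
    [Module.Projective A Q] :
    ∃ (v : El k A W) (α : v ⟶ (El.mk P w).dsum v) (β : (El.mk P w).dsum v ⟶ El.mk P w'),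
      IsConflation α β := by
  have := D.finite_coker_g
  have := D.projective_coker_g
  let R := LinearMap.range D.g
  let a : (Q ⧸ R) →ₗ[A] P × (Q ⧸ R) := R.liftQ ((D.coeff ∘ₗ D.t).prod (R.mkQ ∘ₗ D.t)) (by
    rintro _ ⟨x, rfl⟩
    rw [LinearMap.mem_ker]
    refine Prod.ext ?_ ?_
    · change D.coeff (D.t (D.g x)) = 0
      rw [← D.gt, D.coeff_g, D.πt]
    · change R.mkQ (D.t (D.g x)) = 0
      rw [← D.gt, Submodule.mkQ_apply, Submodule.Quotient.mk_eq_zero]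
      exact ⟨_, rfl⟩)
  have ha : ∀ x, a (R.mkQ x) = (D.coeff (D.t x), R.mkQ (D.t x)) := fun _ => rfl
  let b₂ : (Q ⧸ R) →ₗ[A] P := R.liftQ (D.π ∘ₗ (LinearMap.id - D.g ∘ₗ D.c ∘ₗ D.coeff)) (by
    rintro _ ⟨x, rfl⟩
    rw [LinearMap.mem_ker]
    change D.π (D.g x - D.g (D.c (D.coeff (D.g x)))) = 0
    rw [D.coeff_g, ← map_sub, D.sub_cπ, D.gt, D.πt])
  let b : P × (Q ⧸ R) →ₗ[A] P := (D.π ∘ₗ D.g ∘ₗ D.c).coprod b₂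
  have hb : ∀ p x, b (p, R.mkQ x) = D.π (D.g (D.c p)) + D.π (x - D.g (D.c (D.coeff x))) :=
    fun _ _ => rfl
  have hgc : Intertwines w D.uQ (D.g ∘ₗ D.c) := D.g_intertwines.comp D.c_wQ
  have ia : Intertwines (cokerElt D.g_intertwines) (sumElt k A W w (cokerElt D.g_intertwines)) a :=
    D.g_intertwines.of_mkQ
      ((D.coeff_intertwines.comp D.t_uQ).prod (D.g_intertwines.mkQ.comp D.t_uQ))
  have ib : Intertwines (sumElt k A W w (cokerElt D.g_intertwines)) w' b := by
    refine (D.π_uQ.comp hgc).coprod (D.g_intertwines.of_mkQ ?_)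
    exact D.π_uQ.comp (Intertwines.id.sub (hgc.comp D.coeff_intertwines))
  refine ⟨El.mk (Q ⧸ R) (cokerElt D.g_intertwines), ⟨a, ia⟩, ⟨b, ib⟩, ?_, ?_, ?_⟩
  · change Function.Injective a
    rw [injective_iff_map_eq_zero]
    intro z hz
    obtain ⟨x, rfl⟩ := R.mkQ_surjective z
    rw [ha, Prod.mk_eq_zero, Submodule.mkQ_apply R, Submodule.Quotient.mk_eq_zero] at hz
    obtain ⟨h1, y, hy⟩ := hz
    rw [← hy, D.coeff_g] at h1
    rw [Submodule.mkQ_apply, Submodule.Quotient.mk_eq_zero]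
    refine ⟨D.d y, D.t_injective ?_⟩
    rw [← hy, ← D.gt, ← D.sub_cπ, h1, map_zero, sub_zero]
  · change Function.Exact a b
    rintro ⟨p, z⟩
    obtain ⟨x, rfl⟩ := R.mkQ_surjective z
    constructor
    · intro h0
      rw [hb, ← map_add] at h0
      set y := D.g (D.c p) + (x - D.g (D.c (D.coeff x))) with hy
      have hty : D.t (D.d y) = y := by
        have := D.cπ y
        rwa [h0, map_zero, zero_add] at this
      refine ⟨R.mkQ (D.d y), ?_⟩
      rw [ha, hty]
      refine Prod.ext ?_ ?_
      · change D.coeff y = p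
        rw [hy, map_add, map_sub, D.coeff_g, D.coeff_g, D.πc, D.πc, sub_self, add_zero]
      · change R.mkQ y = R.mkQ x
        rw [Submodule.mkQ_apply, Submodule.mkQ_apply, Submodule.Quotient.eq]
        exact ⟨D.c p - D.c (D.coeff x), by rw [hy, map_sub]; abel⟩
    · rintro ⟨z, hz⟩
      obtain ⟨y, rfl⟩ := R.mkQ_surjective z
      rw [← hz, ha, hb, ← map_add, add_sub_cancel, D.πt]
  · change Function.Surjective b
    intro q
    refine ⟨(D.coeff (D.c q), R.mkQ (D.c q)), ?_⟩
    rw [hb, ← map_add, add_sub_cancel, D.πc]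

/-- With `v` the element induced by `wQ` on `Q / h Q`, the conflation is `p ↦ (π (h c p), d (h c
p))`, the constant term and the rest of `h c p`, followed by `(p, x) ↦ c p + t x`, which puts the
two together again. -/
theorem exists_conflation_right (D : LatticeData w w' Q) [Module.Finite A P] [Module.Projective A P]
    [Module.Projective A Q] :
    ∃ (v : El k A W) (α : El.mk P w' ⟶ (El.mk P w).dsum v) (β : (El.mk P w).dsum v ⟶ v),
      IsConflation α β := by
  have := D.finite_coker_h
  have := D.projective_coker_h
  let R := LinearMap.range D.h
  let f : Q →ₗ[A] P × (Q ⧸ R) := (D.π ∘ₗ D.h).prod (R.mkQ ∘ₗ D.d ∘ₗ D.h)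
  -- `c` need not intertwine `w'` with `uQ`, so that `f ∘ c` is controlled through `f = (f ∘ c) ∘ π`
  have hft : ∀ x, f (D.t x) = 0 := fun x => by
    refine Prod.ext ?_ ?_
    · change D.π (D.h (D.t x)) = 0
      rw [D.ht, D.πt]
    · change R.mkQ (D.d (D.h (D.t x))) = 0
      rw [D.ht, D.dt, Submodule.mkQ_apply, Submodule.Quotient.mk_eq_zero]
      exact ⟨_, rfl⟩
  have hfπ : (f ∘ₗ D.c) ∘ₗ D.π = f := LinearMap.ext fun x => by
    conv_rhs => rw [← D.cπ x, map_add, hft, add_zero]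
    rfl
  let a : P →ₗ[A] P × (Q ⧸ R) := f ∘ₗ D.c
  have ha : ∀ p, a p = (D.π (D.h (D.c p)), R.mkQ (D.d (D.h (D.c p)))) := fun _ => rfl
  let b₂ : (Q ⧸ R) →ₗ[A] (Q ⧸ R) := R.liftQ (R.mkQ ∘ₗ D.t) (by
    rintro _ ⟨x, rfl⟩
    rw [LinearMap.mem_ker, LinearMap.comp_apply, ← D.ht, Submodule.mkQ_apply,
      Submodule.Quotient.mk_eq_zero]
    exact ⟨_, rfl⟩)
  let b : P × (Q ⧸ R) →ₗ[A] (Q ⧸ R) := (R.mkQ ∘ₗ D.c).coprod b₂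
  have hb : ∀ p x, b (p, R.mkQ x) = R.mkQ (D.c p + D.t x) := fun _ _ => rfl
  have ia : Intertwines w' (sumElt k A W w (cokerElt D.h_intertwines)) a := by
    refine D.π_uQ.of_comp_surjective ?_ (fun p => ⟨D.c p, D.πc p⟩)
    rw [hfπ]
    exact (D.π_wQ.comp D.h_intertwines).prod
      (D.h_intertwines.mkQ.comp (D.d_wQ.comp D.h_intertwines))
  have ib : Intertwines (sumElt k A W w (cokerElt D.h_intertwines)) (cokerElt D.h_intertwines) b :=
    (D.h_intertwines.mkQ.comp D.c_wQ).coprod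
      (D.h_intertwines.of_mkQ (D.h_intertwines.mkQ.comp D.t_wQ))
  refine ⟨El.mk (Q ⧸ R) (cokerElt D.h_intertwines), ⟨a, ia⟩, ⟨b, ib⟩, ?_, ?_, ?_⟩
  · change Function.Injective a
    rw [injective_iff_map_eq_zero]
    intro p hp
    rw [ha, Prod.mk_eq_zero, Submodule.mkQ_apply R, Submodule.Quotient.mk_eq_zero] at hp
    obtain ⟨h1, y, hy⟩ := hp
    have h2 := D.cπ (D.h (D.c p))
    rw [h1, map_zero, zero_add, ← hy, ← D.ht] at h2
    rw [← D.πc p, ← D.h_injective h2, D.πt]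
  · change Function.Exact a b
    rintro ⟨p, z⟩
    obtain ⟨x, rfl⟩ := R.mkQ_surjective z
    constructor
    · intro h0
      rw [hb, Submodule.mkQ_apply, Submodule.Quotient.mk_eq_zero] at h0
      obtain ⟨y, hy⟩ := h0
      have key : D.h (D.c (D.π y)) = D.c p + D.t (x - D.h (D.d y)) := by
        rw [map_sub, ← add_sub_assoc, ← hy, ← D.ht, ← map_sub, eq_sub_of_add_eq (D.cπ y)]
      refine ⟨D.π y, ?_⟩
      rw [ha, key]
      refine Prod.ext ?_ ?_
      · change D.π _ = p
        rw [map_add, D.πc, D.πt, add_zero]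
      · change R.mkQ (D.d _) = R.mkQ x
        rw [map_add, D.dc, D.dt, zero_add, Submodule.mkQ_apply, Submodule.mkQ_apply,
          Submodule.Quotient.eq, sub_sub_cancel_left]
        exact neg_mem ⟨_, rfl⟩
    · rintro ⟨q, hq⟩
      rw [← hq, ha, hb, D.cπ, Submodule.mkQ_apply, Submodule.Quotient.mk_eq_zero]
      exact ⟨_, rfl⟩
  · change Function.Surjective b
    intro z
    obtain ⟨x, rfl⟩ := R.mkQ_surjective z
    exact ⟨(D.π x, R.mkQ (D.d x)), by rw [hb, D.cπ]⟩

end LatticeData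
end Lattice

/-! ### Extension of scalars to a commutative algebra -/

section Extension

variable {k A W : Type u} [Field k] [Ring A] [Algebra k A]
  [AddCommGroup W] [Module k W] [Module A W] [Module Aᵐᵒᵖ W]
  [IsScalarTower k A W] [IsScalarTower k Aᵐᵒᵖ W] [SMulCommClass A Aᵐᵒᵖ W]
  {P O : Type u}
  [AddCommGroup P] [Module k P] [Module A P] [IsScalarTower k A P]
  [CommRing O] [Algebra k O]

/-- The `A`-linear map `p ↦ p ⊗ b`. -/
def tmulRight (P : Type u) [AddCommGroup P] [Module k P] [Module A P] [IsScalarTower k A P]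
    (b : O) : P →ₗ[A] P ⊗[k] O where
  toFun p := p ⊗ₜ b
  map_add' p q := TensorProduct.add_tmul p q b
  map_smul' _ _ := rfl

theorem tmulRight_apply (p : P) (b : O) :
    tmulRight (k := k) (A := A) P b p = p ⊗ₜ b := rfl

theorem tmulRight_add (b b' : O) :
    tmulRight (k := k) (A := A) P (b + b') = tmulRight P b + tmulRight P b' :=
  LinearMap.ext fun p => TensorProduct.tmul_add p b b'

theorem tmulRight_smul (r : k) (b : O) :
    tmulRight (k := k) (A := A) P (r • b) = r • tmulRight P b :=
  LinearMap.ext fun p => TensorProduct.tmul_smul r p b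

/-- The `A`-linear map `p ⊗ b ↦ l b • p`. -/
def contract (P : Type u) [AddCommGroup P] [Module k P] [Module A P] [IsScalarTower k A P]
    (l : Module.Dual k O) : P ⊗[k] O →ₗ[A] P :=
  TensorProduct.AlgebraTensorModule.rid k A P ∘ₗ
    TensorProduct.AlgebraTensorModule.map LinearMap.id l

theorem contract_tmul (l : Module.Dual k O) (p : P) (b : O) :
    contract (A := A) P l (p ⊗ₜ b) = l b • p := by
  simp [contract]

/-- For `φ ∈ W(P)` and a `k`-linear endomorphism `T` of `O`, the element `φ ⊗ T` of
`W(P ⊗[k] O)`. -/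
def eltMap (φ : Elts k A W P) (T : Module.End k O) : Elts k A W (P ⊗[k] O) :=
  TensorProduct.AlgebraTensorModule.lift
    { toFun := fun p =>
        { toFun := fun b => bmap k A W (tmulRight P (T b)) (φ p)
          map_add' := fun b c => by
            rw [map_add, tmulRight_add, bmap_add, LinearMap.add_apply]
          map_smul' := fun r b => by
            rw [map_smul, tmulRight_smul, bmap_smul, LinearMap.smul_apply, RingHom.id_apply] }
      map_add' := fun p q => by ext b; simp
      map_smul' := fun a p => by ext b; simp }

theorem eltMap_tmul (φ : Elts k A W P) (T : Module.End k O) (p : P) (b : O) :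
    eltMap φ T (p ⊗ₜ b) = bmap k A W (tmulRight P (T b)) (φ p) := rfl

theorem eltMap_ext {X : Type u} [AddCommGroup X] [Module A X] {f f' : P ⊗[k] O →ₗ[A] X}
    (h : ∀ p b, f (p ⊗ₜ b) = f' (p ⊗ₜ b)) : f = f' := by
  ext x
  induction x using TensorProduct.induction_on with
  | zero => simp
  | tmul p b => exact h p b
  | add x y hx hy => rw [map_add, map_add, hx, hy]

/-- The endomorphism `e ⊗ T` of `P ⊗[k] O`. -/
abbrev endMap (e : Module.End A P) (T : Module.End k O) : Module.End A (P ⊗[k] O) :=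
  TensorProduct.AlgebraTensorModule.map e T

theorem bmap_endMap_comp_eltMap (e : Module.End A P) (S : Module.End k O) (φ : Elts k A W P)
    (T : Module.End k O) :
    bmap k A W (endMap e S) ∘ₗ eltMap φ T = eltMap (bmap k A W e ∘ₗ φ) (S * T) :=
  eltMap_ext fun p b => by
    rw [LinearMap.comp_apply, eltMap_tmul, eltMap_tmul, LinearMap.comp_apply, bmap_bmap, bmap_bmap]
    rfl

theorem eltMap_comp_endMap (e : Module.End A P) (S : Module.End k O) (φ : Elts k A W P)
    (T : Module.End k O) :
    eltMap φ T ∘ₗ endMap e S = eltMap (φ ∘ₗ e) (T * S) :=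
  eltMap_ext fun _ _ => rfl

/-- The `O`-linear endomorphism of `P ⊗[k] O` given by an element of `End_A(P) ⊗[k] O`, recorded as
an `A`-linear map. -/
noncomputable def endExt : Module.End A P ⊗[k] O →ₗ[k] Module.End A (P ⊗[k] O) :=
  TensorProduct.lift (LinearMap.mk₂ k (fun e b => endMap e (LinearMap.mulLeft k b))
    (fun e e' b => eltMap_ext fun p c => by simp [TensorProduct.add_tmul])
    (fun r e b => eltMap_ext fun p c => by simp [TensorProduct.smul_tmul'])
    (fun e b b' => eltMap_ext fun p c => by simp [TensorProduct.tmul_add, add_mul])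
    (fun r e b => eltMap_ext fun p c => by simp))

theorem endExt_tmul (e : Module.End A P) (b : O) :
    endExt (k := k) (e ⊗ₜ b) = endMap e (LinearMap.mulLeft k b) := rfl

/-- The `O`-linear element of `W(P ⊗[k] O)` given by an element of `W(P) ⊗[k] O`. -/
noncomputable def eltExt : Elts k A W P ⊗[k] O →ₗ[k] Elts k A W (P ⊗[k] O) :=
  TensorProduct.lift (LinearMap.mk₂ k (fun φ b => eltMap φ (LinearMap.mulLeft k b))
    (fun φ φ' b => eltMap_ext fun p c => by simp [eltMap_tmul])
    (fun r φ b => eltMap_ext fun p c => by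
      simp [eltMap_tmul, LinearMap.map_smul_of_tower])
    (fun φ b b' => eltMap_ext fun p c => by
      simp [eltMap_tmul, add_mul, tmulRight_add, bmap_add])
    (fun r φ b => eltMap_ext fun p c => by
      simp [eltMap_tmul, tmulRight_smul, bmap_smul]))

theorem eltExt_tmul (φ : Elts k A W P) (b : O) :
    eltExt (φ ⊗ₜ[k] b) = eltMap φ (LinearMap.mulLeft k b) := rfl

theorem endExt_mul (x y : Module.End A P ⊗[k] O) :
    endExt (x * y) = endExt x * endExt y := by
  induction x using TensorProduct.induction_on with
  | zero => simp
  | add x x' hx hx' => rw [add_mul, map_add, hx, hx', map_add, add_mul]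
  | tmul e b =>
    induction y using TensorProduct.induction_on with
    | zero => simp
    | add y y' hy hy' => rw [mul_add, map_add, hy, hy', map_add, mul_add]
    | tmul e' b' =>
      rw [Algebra.TensorProduct.tmul_mul_tmul, endExt_tmul, endExt_tmul, endExt_tmul]
      exact eltMap_ext fun p c => by simp

/-- The bilinear map `(e, f) ↦ (1 ⊗ e) w f`. The orbit of `w` consists of its values at the pairs
`(g, g⁻¹)`. -/
noncomputable def sandwich (w : Elts k A W P) :
    Module.End A P →ₗ[k] Module.End A P →ₗ[k] Elts k A W P :=
  LinearMap.mk₂ k (fun e f => bmap k A W e ∘ₗ w ∘ₗ f)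
    (fun e e' f => by rw [bmap_add, LinearMap.add_comp])
    (fun r e f => by rw [bmap_smul, LinearMap.smul_comp])
    (fun e f f' => by rw [LinearMap.comp_add, LinearMap.comp_add])
    (fun r e f => by
      ext x
      simp only [LinearMap.comp_apply, LinearMap.smul_apply, LinearMap.map_smul_of_tower])

/-- The extension of a `k`-bilinear map to an `O`-bilinear map, recorded as a `k`-bilinear map. -/
noncomputable abbrev bilinExt {E M : Type*} [AddCommGroup E] [Module k E] [AddCommGroup M]
    [Module k M] (B : E →ₗ[k] E →ₗ[k] M) (O : Type*) [CommRing O] [Algebra k O] :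
    E ⊗[k] O →ₗ[k] E ⊗[k] O →ₗ[k] M ⊗[k] O :=
  TensorProduct.map₂ B (LinearMap.mul k O)

theorem eltExt_bilinExt_sandwich (w : Elts k A W P) (x y : Module.End A P ⊗[k] O) :
    eltExt (bilinExt (sandwich w) O x y) =
      bmap k A W (endExt x) ∘ₗ eltMap w 1 ∘ₗ endExt y := by
  induction x using TensorProduct.induction_on with
  | zero => simp [bmap_zero]
  | add x x' hx hx' =>
    rw [map_add, LinearMap.add_apply, map_add, hx, hx', map_add, bmap_add, LinearMap.add_comp]
  | tmul e b =>
    induction y using TensorProduct.induction_on with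
    | zero => simp
    | add y y' hy hy' =>
      rw [map_add, map_add, hy, hy', map_add, LinearMap.comp_add, LinearMap.comp_add]
    | tmul e' b' =>
      rw [TensorProduct.map₂_apply_tmul, TensorProduct.map_tmul, eltExt_tmul, endExt_tmul,
        endExt_tmul, eltMap_comp_endMap, bmap_endMap_comp_eltMap]
      exact eltMap_ext fun p c => by simp [eltMap_tmul, sandwich]

theorem eltMap_one_intertwines_endMap (w : Elts k A W P) (T : Module.End k O) :
    Intertwines (eltMap w 1) (eltMap w 1) (endMap 1 T) := by
  rw [Intertwines, bmap_endMap_comp_eltMap, eltMap_comp_endMap, mul_one, one_mul,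
    Module.End.one_eq_id, bmap_id]
  rfl

/-- Elements of `W(P ⊗ O)` coming from `W(P) ⊗ O` are `O`-linear. -/
theorem eltExt_intertwines_mul (x : Elts k A W P ⊗[k] O) (t : O) :
    Intertwines (eltExt x) (eltExt x) (endMap 1 (LinearMap.mulLeft k t)) := by
  rw [Intertwines]
  induction x using TensorProduct.induction_on with
  | zero => simp
  | add x y hx hy => rw [map_add, LinearMap.comp_add, hx, hy, LinearMap.add_comp]
  | tmul φ b =>
    rw [eltExt_tmul, bmap_endMap_comp_eltMap, eltMap_comp_endMap, Module.End.one_eq_id, bmap_id]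
    exact eltMap_ext fun p c => by simp [eltMap_tmul, mul_left_comm]

theorem tmulRight_intertwines (w : Elts k A W P) (b : O) :
    Intertwines w (eltMap w 1) (tmulRight P b) :=
  LinearMap.ext fun _ => rfl

theorem contract_comp_tmulRight (l : Module.Dual k O) (b : O) :
    contract (A := A) P l ∘ₗ tmulRight P b = l b • LinearMap.id :=
  LinearMap.ext fun p => contract_tmul l p b

/-- The constant family given by `w` is compatible with every `k`-linear form on `O`, multiplicative
or not. -/
theorem contract_intertwines (w : Elts k A W P) (l : Module.Dual k O) :
    Intertwines (eltMap w 1) w (contract P l) :=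
  eltMap_ext fun p b => by
    rw [LinearMap.comp_apply, LinearMap.comp_apply, eltMap_tmul, bmap_bmap,
      contract_comp_tmulRight, contract_tmul, bmap_smul, bmap_id, LinearMap.map_smul_of_tower]
    rfl

/-- The value of an element of `M ⊗[k] O` at the `k`-point `ε` of `O`. -/
noncomputable def evalAt (M : Type*) [AddCommGroup M] [Module k M] {O : Type*} [CommRing O]
    [Algebra k O] (ε : O →ₐ[k] k) : M ⊗[k] O →ₗ[k] M :=
  TensorProduct.rid k M ∘ₗ LinearMap.lTensor M ε.toLinearMap

theorem evalAt_tmul {M : Type*} [AddCommGroup M] [Module k M] {O : Type*} [CommRing O]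
    [Algebra k O] (ε : O →ₐ[k] k) (m : M) (b : O) : evalAt M ε (m ⊗ₜ b) = ε b • m := by
  simp [evalAt]

/-- The fibre of the family `x` at the point `ε` is the value of `x` at `ε`. -/
theorem contract_intertwines_evalAt (x : Elts k A W P ⊗[k] O) (ε : O →ₐ[k] k) :
    Intertwines (eltExt x) (evalAt _ ε x) (contract P ε.toLinearMap) := by
  rw [Intertwines]
  induction x using TensorProduct.induction_on with
  | zero => simp
  | add x y hx hy => rw [map_add, LinearMap.comp_add, hx, hy, map_add, LinearMap.add_comp]
  | tmul φ b =>
    refine eltMap_ext fun p c => ?_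
    rw [LinearMap.comp_apply, LinearMap.comp_apply, eltExt_tmul, evalAt_tmul, eltMap_tmul,
      bmap_bmap, contract_comp_tmulRight, contract_tmul, bmap_smul, bmap_id, LinearMap.smul_apply,
      LinearMap.map_smul_of_tower, LinearMap.mulLeft_apply, AlgHom.toLinearMap_apply, map_mul,
      mul_comm, mul_smul]
    rfl

end Extension

/-! ### The lattice of an arc -/

/-- An arc through `m` in the image of `e ↦ B(e, e⁻¹)`, for a bilinear map `B` on an algebra `E`: a
commutative algebra `O` with a `k`-point `ε` whose ideal is generated by a regular element `t`, and
a unit `g` of `E ⊗ O[1/t]` such that `x = B(g, g⁻¹)` is defined over `O` and takes the value `m` at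
`ε`. The inverse of `g` is encoded by `h = t ^ N g⁻¹`; only `g` and `h` in `E ⊗ O` are recorded, so
that no localisation is needed. -/
structure Arc {k E M : Type*} [Field k] [Ring E] [Algebra k E] [AddCommGroup M] [Module k M]
    (B : E →ₗ[k] E →ₗ[k] M) (m : M) (O : Type*) [CommRing O] [Algebra k O] where
  /-- The uniformizer. -/
  t : O
  /-- The special point. -/
  ε : O →ₐ[k] k
  /-- The order of the denominator of `g⁻¹`. -/
  N : ℕ
  /-- The generic unit of the arc. -/
  g : E ⊗[k] O
  /-- The element `t ^ N g⁻¹`. -/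
  h : E ⊗[k] O
  /-- The element `B(g, g⁻¹)`. -/
  x : M ⊗[k] O
  t_regular : IsLeftRegular t
  ε_t : ε t = 0
  dvd_of_ε : ∀ b, ε b = 0 → t ∣ b
  gh : g * h = (1 : E) ⊗ₜ[k] (t ^ N)
  hg : h * g = (1 : E) ⊗ₜ[k] (t ^ N)
  bilin : bilinExt B O g h = LinearMap.lTensor M (LinearMap.mulLeft k (t ^ N)) x
  evalAt_x : evalAt M ε x = m

namespace Arc

section Difference

variable {k E M : Type*} [Field k] [Ring E] [Algebra k E] [AddCommGroup M] [Module k M]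
    {B : E →ₗ[k] E →ₗ[k] M} {m : M} {O : Type*} [CommRing O] [Algebra k O] (D : Arc B m O)

theorem exists_diffQuot :
    ∃ d : Module.End k O, ∀ b, algebraMap k O (D.ε b) + D.t * d b = b := by
  have (b : O) : ∃ c, algebraMap k O (D.ε b) + D.t * c = b := by
    obtain ⟨c, hc⟩ := D.dvd_of_ε (b - algebraMap k O (D.ε b)) (by simp)
    exact ⟨c, by rw [← hc, add_sub_cancel]⟩
  choose d hd using this
  refine ⟨{ toFun := d, map_add' := fun b c => D.t_regular ?_,
            map_smul' := fun r b => D.t_regular ?_ }, hd⟩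
  · have h := hd (b + c)
    rw [map_add, map_add] at h
    linear_combination h - hd b - hd c
  · have h := hd (r • b)
    rw [map_smul, smul_eq_mul, map_mul, Algebra.smul_def] at h
    rw [RingHom.id_apply, Algebra.smul_def, Algebra.smul_def]
    linear_combination h - algebraMap k O r * hd b

/-- The `k`-linear map `b ↦ (b - ε b) / t`. -/
noncomputable def diffQuot : Module.End k O := D.exists_diffQuot.choose

theorem diffQuot_spec (b : O) : algebraMap k O (D.ε b) + D.t * D.diffQuot b = b :=
  D.exists_diffQuot.choose_spec b

theorem diffQuot_t_mul (b : O) : D.diffQuot (D.t * b) = b := D.t_regular <| by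
  simpa [D.ε_t] using D.diffQuot_spec (D.t * b)

end Difference

section Lattice

variable {k A W : Type u} [Field k] [Ring A] [Algebra k A]
  [AddCommGroup W] [Module k W] [Module A W] [Module Aᵐᵒᵖ W]
  [IsScalarTower k A W] [IsScalarTower k Aᵐᵒᵖ W] [SMulCommClass A Aᵐᵒᵖ W]
  {P O : Type u}
  [AddCommGroup P] [Module k P] [Module A P] [IsScalarTower k A P]
  [CommRing O] [Algebra k O] {w w' : Elts k A W P} (D : Arc (sandwich w) w' O)

theorem endExt_one_tmul (b : O) :
    endExt (k := k) ((1 : Module.End A P) ⊗ₜ b) = endMap 1 (LinearMap.mulLeft k b) := rfl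

theorem endMap_one_pow (T : Module.End k O) (n : ℕ) :
    endMap (1 : Module.End A P) T ^ n = endMap 1 (T ^ n) := by
  induction n with
  | zero => exact eltMap_ext fun p b => by simp
  | succ n ih => rw [pow_succ, ih, pow_succ]; exact eltMap_ext fun p b => by simp

theorem endMap_one_mulLeft_pow (b : O) (n : ℕ) :
    endMap (1 : Module.End A P) (LinearMap.mulLeft k b) ^ n =
      endMap 1 (LinearMap.mulLeft k (b ^ n)) := by
  rw [endMap_one_pow]
  congr 1
  rw [LinearMap.pow_mulLeft]

theorem endExt_comm (x : Module.End A P ⊗[k] O) (b : O) (y : P ⊗[k] O) :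
    endExt x (endMap (1 : Module.End A P) (LinearMap.mulLeft k b) y) =
      endMap (1 : Module.End A P) (LinearMap.mulLeft k b) (endExt x y) := by
  rw [← endExt_one_tmul, ← Module.End.mul_apply, ← Module.End.mul_apply, ← endExt_mul,
    ← endExt_mul]
  congr 2
  induction x using TensorProduct.induction_on with
  | zero => simp
  | add x x' hx hx' => rw [add_mul, mul_add, hx, hx']
  | tmul e c => simp [mul_comm]

theorem eltExt_lTensor_mulLeft (x : Elts k A W P ⊗[k] O) (b : O) :
    eltExt (LinearMap.lTensor _ (LinearMap.mulLeft k b) x) =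
      bmap k A W (endMap 1 (LinearMap.mulLeft k b)) ∘ₗ eltExt x := by
  induction x using TensorProduct.induction_on with
  | zero => simp
  | add x y hx hy => rw [map_add, map_add, hx, hy, map_add, LinearMap.comp_add]
  | tmul φ c =>
    rw [LinearMap.lTensor_tmul, eltExt_tmul, eltExt_tmul, bmap_endMap_comp_eltMap,
      Module.End.one_eq_id, bmap_id]
    exact eltMap_ext fun p d => by simp [eltMap_tmul]

theorem diffQuot_pow_t_pow_mul (n : ℕ) (b : O) : (D.diffQuot ^ n) (D.t ^ n * b) = b := by
  induction n generalizing b with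
  | zero => simp
  | succ n ih => rw [pow_succ, pow_succ', mul_assoc, Module.End.mul_apply, D.diffQuot_t_mul, ih]

theorem bmap_endMap_t_pow_injective (n : ℕ) : Function.Injective
    (bmap k A W (endMap (1 : Module.End A P) (LinearMap.mulLeft k (D.t ^ n)))) := by
  refine Function.LeftInverse.injective
    (g := bmap k A W (endMap (1 : Module.End A P) (D.diffQuot ^ n))) fun y => ?_
  rw [bmap_bmap]
  refine Eq.trans (congrArg (fun f => bmap k A W f y) ?_) (LinearMap.congr_fun (bmap_id k A W) y)
  exact eltMap_ext fun p b => by simp [D.diffQuot_pow_t_pow_mul]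

/-- After inverting `t`, the family `x` is `g w g⁻¹`. -/
theorem bmap_t_pow_comp_eltExt :
    bmap k A W (endMap 1 (LinearMap.mulLeft k (D.t ^ D.N))) ∘ₗ eltExt D.x =
      bmap k A W (endExt D.g) ∘ₗ eltMap w 1 ∘ₗ endExt D.h := by
  rw [← eltExt_lTensor_mulLeft, ← D.bilin, eltExt_bilinExt_sandwich]

theorem endExt_gh (y : P ⊗[k] O) :
    endExt D.g (endExt D.h y) =
      endMap (1 : Module.End A P) (LinearMap.mulLeft k (D.t ^ D.N)) y := by
  rw [← Module.End.mul_apply, ← endExt_mul, D.gh]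
  rfl

theorem endExt_hg (y : P ⊗[k] O) :
    endExt D.h (endExt D.g y) =
      endMap (1 : Module.End A P) (LinearMap.mulLeft k (D.t ^ D.N)) y := by
  rw [← Module.End.mul_apply, ← endExt_mul, D.hg]
  rfl

theorem g_intertwines : Intertwines (eltMap w 1) (eltExt D.x) (endExt D.g) := by
  refine LinearMap.ext fun y => D.bmap_endMap_t_pow_injective D.N ?_
  have h1 := LinearMap.congr_fun D.bmap_t_pow_comp_eltExt (endExt D.g y)
  simp only [LinearMap.comp_apply] at h1 ⊢
  rw [h1, D.endExt_hg, ← (eltMap_one_intertwines_endMap w _).apply, bmap_bmap, bmap_bmap]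
  congr 2
  exact LinearMap.ext fun y => (endExt_comm D.g _ y).symm

theorem h_intertwines : Intertwines (eltExt D.x) (eltMap w 1) (endExt D.h) := by
  refine LinearMap.ext fun y => D.bmap_endMap_t_pow_injective D.N ?_
  have h1 := LinearMap.congr_fun D.bmap_t_pow_comp_eltExt y
  have h2 := congrArg (bmap k A W (endExt D.h)) h1
  simp only [LinearMap.comp_apply] at h2 ⊢
  rw [bmap_bmap, bmap_bmap] at h2
  rw [bmap_bmap]
  convert h2 using 3
  · exact LinearMap.ext fun y => (endExt_comm D.h _ y).symm
  · exact LinearMap.ext fun y => (D.endExt_hg y).symm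

/-- The module `P ⊗ O`, with the constant family of `w` and the family `x = g w g⁻¹`, joins `w` to
`w'`. -/
noncomputable def latticeData : LatticeData w w' (P ⊗[k] O) where
  wQ := eltMap w 1
  uQ := eltExt D.x
  t := endMap 1 (LinearMap.mulLeft k D.t)
  d := endMap 1 D.diffQuot
  g := endExt D.g
  h := endExt D.h
  c := tmulRight P 1
  π := contract P D.ε.toLinearMap
  N := D.N
  dt := LinearMap.congr_fun (g := LinearMap.id) <| eltMap_ext (f := endMap _ _ ∘ₗ endMap _ _)
    fun p b => by simp [D.diffQuot_t_mul]
  πc p := (contract_tmul _ p 1).trans (by simp)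
  πt := LinearMap.congr_fun (g := 0) <| eltMap_ext (f := contract P _ ∘ₗ endMap _ _)
    fun p b => by simp [contract_tmul, D.ε_t]
  cπ := LinearMap.congr_fun (g := LinearMap.id) <| eltMap_ext
    (f := tmulRight P 1 ∘ₗ contract P D.ε.toLinearMap +
      endMap 1 (LinearMap.mulLeft k D.t) ∘ₗ endMap 1 D.diffQuot) fun p b => by
    conv_rhs => rw [← D.diffQuot_spec b]
    simp [contract_tmul, tmulRight_apply, TensorProduct.tmul_add, Algebra.algebraMap_eq_smul_one,
      TensorProduct.smul_tmul']
  gh x := by rw [endMap_one_mulLeft_pow]; exact D.endExt_gh x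
  hg x := by rw [endMap_one_mulLeft_pow]; exact D.endExt_hg x
  gt := endExt_comm D.g D.t
  ht := endExt_comm D.h D.t
  g_intertwines := D.g_intertwines
  h_intertwines := D.h_intertwines
  t_wQ := eltMap_one_intertwines_endMap w _
  t_uQ := eltExt_intertwines_mul D.x D.t
  d_wQ := eltMap_one_intertwines_endMap w _
  c_wQ := tmulRight_intertwines w 1
  π_wQ := contract_intertwines w _
  π_uQ := by simpa only [D.evalAt_x] using contract_intertwines_evalAt D.x D.ε

end Lattice
end Arc

/-! ### Existence of arcs -/

section BaseChange

variable {k E M : Type*} [Field k] [Ring E] [Algebra k E] [AddCommGroup M] [Module k M]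
  (B : E →ₗ[k] E →ₗ[k] M) {O O' : Type*} [CommRing O] [Algebra k O] [CommRing O'] [Algebra k O']

/-- Extension of scalars `E ⊗ O → E ⊗ O'` along `φ : O → O'`. -/
noncomputable abbrev scalarMap (E : Type*) [Ring E] [Algebra k E] (φ : O →ₐ[k] O') :
    E ⊗[k] O →ₐ[k] E ⊗[k] O' :=
  Algebra.TensorProduct.map (AlgHom.id k E) φ

theorem evalAt_mul (φ : O →ₐ[k] k) (x y : E ⊗[k] O) :
    evalAt E φ (x * y) = evalAt E φ x * evalAt E φ y := by
  induction x using TensorProduct.induction_on with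
  | zero => simp
  | add x x' hx hx' => rw [add_mul, map_add, hx, hx', map_add, add_mul]
  | tmul e b =>
    induction y using TensorProduct.induction_on with
    | zero => simp
    | add y y' hy hy' => rw [mul_add, map_add, hy, hy', map_add, mul_add]
    | tmul e' b' =>
      rw [Algebra.TensorProduct.tmul_mul_tmul]
      simp only [evalAt_tmul, smul_mul_smul_comm, map_mul]

theorem evalAt_bilinExt (φ : O →ₐ[k] k) (x y : E ⊗[k] O) :
    evalAt M φ (bilinExt B O x y) = B (evalAt E φ x) (evalAt E φ y) := by
  induction x using TensorProduct.induction_on with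
  | zero => simp
  | add x x' hx hx' => simp only [map_add, LinearMap.add_apply, hx, hx']
  | tmul e b =>
    induction y using TensorProduct.induction_on with
    | zero => simp
    | add y y' hy hy' => simp only [map_add, hy, hy']
    | tmul e' b' =>
      simp only [TensorProduct.map₂_apply_tmul, TensorProduct.map_tmul, LinearMap.mul_apply',
        evalAt_tmul, map_mul, map_smul, LinearMap.smul_apply, smul_smul, mul_comm]

theorem lTensor_bilinExt (φ : O →ₐ[k] O') (x y : E ⊗[k] O) :
    LinearMap.lTensor M φ.toLinearMap (bilinExt B O x y) =
      bilinExt B O' (scalarMap E φ x) (scalarMap E φ y) := by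
  induction x using TensorProduct.induction_on with
  | zero => simp
  | add x x' hx hx' => simp only [map_add, LinearMap.add_apply, hx, hx']
  | tmul e b =>
    induction y using TensorProduct.induction_on with
    | zero => simp
    | add y y' hy hy' => simp only [map_add, hy, hy']
    | tmul e' b' => simp

theorem one_tmul_comm (r : O) (x : E ⊗[k] O) :
    ((1 : E) ⊗ₜ[k] r) * x = x * ((1 : E) ⊗ₜ[k] r) := by
  induction x using TensorProduct.induction_on with
  | zero => simp
  | add x x' hx hx' => rw [mul_add, add_mul, hx, hx']
  | tmul e b => simp [mul_comm]

theorem bilinExt_scale_left (r : O) (x y : E ⊗[k] O) :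
    bilinExt B O (((1 : E) ⊗ₜ[k] r) * x) y =
      LinearMap.lTensor M (LinearMap.mulLeft k r) (bilinExt B O x y) := by
  induction x using TensorProduct.induction_on with
  | zero => simp
  | add x x' hx hx' => simp only [mul_add, map_add, LinearMap.add_apply, hx, hx']
  | tmul e b =>
    induction y using TensorProduct.induction_on with
    | zero => simp
    | add y y' hy hy' => simp only [map_add, hy, hy']
    | tmul e' b' => simp [mul_assoc]

theorem bilinExt_scale_right (r : O) (x y : E ⊗[k] O) :
    bilinExt B O x (((1 : E) ⊗ₜ[k] r) * y) =
      LinearMap.lTensor M (LinearMap.mulLeft k r) (bilinExt B O x y) := by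
  induction x using TensorProduct.induction_on with
  | zero => simp
  | add x x' hx hx' => simp only [map_add, LinearMap.add_apply, hx, hx']
  | tmul e b =>
    induction y using TensorProduct.induction_on with
    | zero => simp
    | add y y' hy hy' => simp only [mul_add, map_add, hy, hy']
    | tmul e' b' => simp [mul_left_comm]

theorem lTensor_mulLeft_mulLeft (r s : O) (x : M ⊗[k] O) :
    LinearMap.lTensor M (LinearMap.mulLeft k r) (LinearMap.lTensor M (LinearMap.mulLeft k s) x) =
      LinearMap.lTensor M (LinearMap.mulLeft k (r * s)) x := by
  rw [← LinearMap.comp_apply, ← LinearMap.lTensor_comp, LinearMap.mulLeft_mul]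

/-- The elements `g`, `h` of `E ⊗ O` are inverse to each other up to the factor `f`, and
`x = B(g, g⁻¹)` after inverting `f`. -/
structure IsConj (f : O) (g h : E ⊗[k] O) (x : M ⊗[k] O) : Prop where
  gh : g * h = (1 : E) ⊗ₜ[k] f
  hg : h * g = (1 : E) ⊗ₜ[k] f
  bilin : bilinExt B O g h = LinearMap.lTensor M (LinearMap.mulLeft k f) x

namespace IsConj

variable {B} {f : O} {g h : E ⊗[k] O} {x : M ⊗[k] O}

theorem map (H : IsConj B f g h x) (φ : O →ₐ[k] O') :
    IsConj B (φ f) (scalarMap E φ g) (scalarMap E φ h) (LinearMap.lTensor M φ.toLinearMap x) where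
  gh := by rw [← map_mul, H.gh]; simp
  hg := by rw [← map_mul, H.hg]; simp
  bilin := by
    rw [← lTensor_bilinExt, H.bilin, ← LinearMap.comp_apply, ← LinearMap.comp_apply,
      ← LinearMap.lTensor_comp, ← LinearMap.lTensor_comp]
    congr 2
    ext b
    simp

theorem of_map {φ : O →ₐ[k] O'} (hφ : Function.Injective φ)
    (H : IsConj B (φ f) (scalarMap E φ g) (scalarMap E φ h) (LinearMap.lTensor M φ.toLinearMap x)) :
    IsConj B f g h x := by
  have hE : Function.Injective (scalarMap E φ) :=
    Module.Flat.lTensor_preserves_injective_linearMap (M := E) φ.toLinearMap hφ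
  have hM : Function.Injective (LinearMap.lTensor M φ.toLinearMap) :=
    Module.Flat.lTensor_preserves_injective_linearMap (M := M) φ.toLinearMap hφ
  refine ⟨hE ?_, hE ?_, hM ?_⟩
  · rw [map_mul, H.gh]; simp
  · rw [map_mul, H.hg]; simp
  · rw [lTensor_bilinExt, H.bilin, ← LinearMap.comp_apply, ← LinearMap.comp_apply,
      ← LinearMap.lTensor_comp, ← LinearMap.lTensor_comp]
    congr 2
    ext b
    simp

theorem scale_left (H : IsConj B f g h x) (r : O) :
    IsConj B (r * f) (((1 : E) ⊗ₜ[k] r) * g) h x where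
  gh := by rw [mul_assoc, H.gh, Algebra.TensorProduct.tmul_mul_tmul, one_mul]
  hg := by
    rw [← mul_assoc, ← one_tmul_comm, mul_assoc, H.hg, Algebra.TensorProduct.tmul_mul_tmul,
      one_mul]
  bilin := by rw [bilinExt_scale_left, H.bilin, lTensor_mulLeft_mulLeft]

theorem scale_right (H : IsConj B f g h x) (r : O) :
    IsConj B (r * f) g (((1 : E) ⊗ₜ[k] r) * h) x where
  gh := by
    rw [← mul_assoc, ← one_tmul_comm, mul_assoc, H.gh, Algebra.TensorProduct.tmul_mul_tmul,
      one_mul]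
  hg := by rw [mul_assoc, H.hg, Algebra.TensorProduct.tmul_mul_tmul, one_mul]
  bilin := by rw [bilinExt_scale_right, H.bilin, lTensor_mulLeft_mulLeft]

end IsConj

/-- Denominators of an element of `E ⊗ T` can be cleared by a power of `c` when those of all
elements of `T` can. -/
theorem exists_scalarMap_eq {K T : Type*} [Field K] [Algebra k K] [CommRing T] [Algebra k T]
    (τ : T →ₐ[k] K) (S : Subalgebra k K) (c : S) (hc : ∀ z : T, ∃ n : ℕ, (c : K) ^ n * τ z ∈ S)
    (z : E ⊗[k] T) : ∃ (n : ℕ) (z' : E ⊗[k] S),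
      scalarMap E S.val z' = ((1 : E) ⊗ₜ[k] ((c : K) ^ n)) * scalarMap E τ z := by
  induction z using TensorProduct.induction_on with
  | zero => exact ⟨0, 0, by simp⟩
  | tmul e b =>
    obtain ⟨n, hn⟩ := hc b
    exact ⟨n, e ⊗ₜ ⟨_, hn⟩, by simp⟩
  | add x y hx hy =>
    obtain ⟨n, x', hx'⟩ := hx
    obtain ⟨m, y', hy'⟩ := hy
    refine ⟨n + m, ((1 : E) ⊗ₜ (c ^ m)) * x' + ((1 : E) ⊗ₜ (c ^ n)) * y', ?_⟩
    rw [map_add, map_mul, map_mul, hx', hy', map_add, mul_add]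
    simp [← mul_assoc, pow_add, mul_comm]

end BaseChange

section GenericUnit

variable {k : Type u} {E : Type*} [Field k] [Ring E] [Algebra k E] [Module.Finite k E]

/-- A surjective endomorphism of the finite `T`-module `E ⊗ T` is injective. -/
theorem mul_eq_one_of_mul_eq_one {T : Type*} [CommRing T] [Algebra k T] {g h : E ⊗[k] T}
    (H : g * h = 1) : h * g = 1 := by
  let c := Algebra.TensorProduct.comm k E T
  have H' : c g * c h = 1 := by rw [← map_mul, H, map_one]
  have hs : Function.Surjective (LinearMap.mulLeft T (c g)) := fun y =>
    ⟨c h * y, by rw [LinearMap.mulLeft_apply, ← mul_assoc, H', one_mul]⟩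
  have hi := OrzechProperty.injective_of_surjective_endomorphism _ hs
  apply c.injective
  apply hi
  rw [map_mul, map_one, LinearMap.mulLeft_apply, LinearMap.mulLeft_apply, ← mul_assoc, H', one_mul,
    mul_one]

/-- If `L` is the matrix of left multiplication by `g = ∑ bᵢ ⊗ xᵢ`, then a solution `y` of `L y = 1`
gives a right inverse of `g`. -/
theorem sum_tmul_mul_sum_tmul {ι T : Type*} [Fintype ι] [DecidableEq ι] [CommRing T] [Algebra k T]
    (b : Module.Basis ι k E) (x y : ι → T) {L : Matrix ι ι T}
    (hL : ∀ l j, L l j = ∑ i, x i * algebraMap k T (Algebra.leftMulMatrix b (b i) l j))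
    (hy : L.mulVec y = fun i => algebraMap k T (b.repr 1 i)) :
    (∑ i, b i ⊗ₜ[k] x i) * (∑ j, b j ⊗ₜ[k] y j) = 1 := by
  have h1 (i j) : b i * b j = ∑ l, Algebra.leftMulMatrix b (b i) l j • b l := by
    conv_lhs => rw [← b.sum_repr (b i * b j)]
    simp only [Algebra.leftMulMatrix_eq_repr_mul]
  have h2 (l) : ∑ i, ∑ j, Algebra.leftMulMatrix b (b i) l j • (x i * y j) = L.mulVec y l := by
    simp only [Matrix.mulVec, dotProduct, hL, Finset.sum_mul]
    rw [Finset.sum_comm]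
    refine Finset.sum_congr rfl fun j _ => Finset.sum_congr rfl fun i _ => ?_
    rw [Algebra.smul_def]
    ring
  calc (∑ i, b i ⊗ₜ[k] x i) * (∑ j, b j ⊗ₜ[k] y j)
      = ∑ i, ∑ j, ∑ l, b l ⊗ₜ[k] (Algebra.leftMulMatrix b (b i) l j • (x i * y j)) := by
        simp only [Finset.sum_mul_sum, Algebra.TensorProduct.tmul_mul_tmul, h1,
          TensorProduct.sum_tmul, TensorProduct.smul_tmul]
    _ = ∑ l, b l ⊗ₜ[k] (L.mulVec y l) := by
        simp only [← h2, TensorProduct.tmul_sum]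
        refine (Finset.sum_congr rfl fun i _ => Finset.sum_comm).trans Finset.sum_comm
    _ = (∑ l, b.repr 1 l • b l) ⊗ₜ[k] (1 : T) := by
        simp only [hy, TensorProduct.sum_tmul, TensorProduct.smul_tmul,
          Algebra.algebraMap_eq_smul_one]
    _ = 1 := by rw [b.sum_repr]; rfl

/-- The coordinate ring `T` of the group of units of a finite dimensional algebra `E`, with the
generic unit `g` and its inverse `h`: every unit of `E` is the value of `g` at some `k`-point of
`T`. The ring `T` is the localisation of a polynomial ring, in the coordinates of `E`, at the
determinant of left multiplication. -/
theorem exists_generic_unit (k : Type u) (E : Type*) [Field k] [Ring E] [Algebra k E]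
    [Module.Finite k E] : ∃ (T : Type u) (_ : CommRing T) (_ : IsDomain T) (_ : Algebra k T)
      (_ : Algebra.FiniteType k T) (g h : E ⊗[k] T), g * h = 1 ∧ h * g = 1 ∧
      ∀ e : Eˣ, ∃ φ : T →ₐ[k] k, evalAt E φ g = e ∧ evalAt E φ h = ↑e⁻¹ := by
  classical
  let b := Module.finBasis k E
  let R := MvPolynomial (Fin (Module.finrank k E)) k
  let L : Matrix (Fin (Module.finrank k E)) (Fin (Module.finrank k E)) R :=
    ∑ i, (MvPolynomial.X i : R) • (Algebra.leftMulMatrix b (b i)).map MvPolynomial.C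
  have hL (e : E) : L.map (MvPolynomial.aeval (b.repr e)) = Algebra.leftMulMatrix b e := by
    conv_rhs => rw [← b.sum_repr e, map_sum]
    ext i j
    simp only [L, Matrix.map_apply, Matrix.sum_apply, Matrix.smul_apply, map_sum, map_smul,
      smul_eq_mul, map_mul, MvPolynomial.aeval_X, MvPolynomial.aeval_C]
    rfl
  have hdet (e : E) : MvPolynomial.aeval (b.repr e) L.det = (Algebra.leftMulMatrix b e).det := by
    rw [← hL e]
    exact RingHom.map_det (MvPolynomial.aeval (b.repr e)).toRingHom L
  have hd : L.det ≠ 0 := fun h0 => by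
    have := hdet 1
    rw [h0, map_zero, map_one, Matrix.det_one] at this
    exact zero_ne_one this
  let T := Localization.Away L.det
  have hT : IsDomain T :=
    IsLocalization.isDomain_localization (powers_le_nonZeroDivisors_of_noZeroDivisors hd)
  have hfin : Algebra.FiniteType k T :=
    have : Algebra.FiniteType R T := IsLocalization.finiteType_of_monoid_fg (.powers L.det) T
    Algebra.FiniteType.trans (S := R) inferInstance this
  let LT := L.map (algebraMap R T)
  have hLT : IsUnit LT.det := by
    have : LT.det = algebraMap R T L.det := (RingHom.map_det (algebraMap R T) L).symm
    rw [this]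
    exact IsLocalization.Away.algebraMap_isUnit L.det
  let y : Fin (Module.finrank k E) → T :=
    LT⁻¹.mulVec fun i => algebraMap k T (b.repr 1 i)
  have hy : LT.mulVec y = fun i => algebraMap k T (b.repr 1 i) := by
    rw [Matrix.mulVec_mulVec, Matrix.mul_nonsing_inv _ hLT, Matrix.one_mulVec]
  let g : E ⊗[k] T := ∑ i, b i ⊗ₜ algebraMap R T (MvPolynomial.X i)
  let h : E ⊗[k] T := ∑ j, b j ⊗ₜ y j
  have hLT' (l j) : LT l j = ∑ i, algebraMap R T (MvPolynomial.X i) *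
      algebraMap k T (Algebra.leftMulMatrix b (b i) l j) := by
    simp only [LT, L, Matrix.map_apply, Matrix.sum_apply, Matrix.smul_apply, map_sum, smul_eq_mul,
      map_mul]
    refine Finset.sum_congr rfl fun i _ => ?_
    rw [IsScalarTower.algebraMap_apply k R T]
    rfl
  have hgh : g * h = 1 := sum_tmul_mul_sum_tmul b _ y hLT' hy
  refine ⟨T, inferInstance, hT, inferInstance, hfin, g, h, hgh, mul_eq_one_of_mul_eq_one hgh,
    fun e => ?_⟩
  have hu : ∀ z : Submonoid.powers L.det,
      IsUnit (MvPolynomial.aeval (R := k) (b.repr e) (z : R)) := by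
    rintro ⟨_, n, rfl⟩
    rw [map_pow, hdet]
    exact (((e.isUnit.map (Algebra.leftMulMatrix b)).map Matrix.detMonoidHom).pow n)
  let φ : T →ₐ[k] k := IsLocalization.liftAlgHom (M := Submonoid.powers L.det) hu
  have hφ (z : R) : φ (algebraMap R T z) = MvPolynomial.aeval (b.repr e) z :=
    IsLocalization.lift_eq _ z
  have hg : evalAt E φ g = e := by
    simp only [g, map_sum, evalAt_tmul, hφ, MvPolynomial.aeval_X]
    exact b.sum_repr _
  refine ⟨φ, hg, ?_⟩
  rw [← Units.mul_right_inj e, ← hg, ← evalAt_mul, hgh, hg, Units.mul_inv,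
    Algebra.TensorProduct.one_def, evalAt_tmul, map_one, one_smul]

end GenericUnit

section ExistsArc

variable {k M : Type u} {E : Type*} [Field k] [Ring E] [Algebra k E] [Module.Finite k E]
  [AddCommGroup M] [Module k M] [Module.Finite k M]

theorem eval_mem_polyFun {σ : Type*} (l : σ → Module.Dual k M) (F : MvPolynomial σ k) :
    (fun v => MvPolynomial.eval (fun j => l j v) F) ∈ polyFun k M := by
  have : (fun v => MvPolynomial.eval (fun j => l j v) F) =
      MvPolynomial.aeval (fun j => (l j : M → k)) F := by
    ext v
    exact (DFunLike.congr_fun (MvPolynomial.comp_aeval (R := k) (fun j => (l j : M → k))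
      (Pi.evalAlgHom k (fun _ : M => k) v)) F).symm
  rw [this]
  clear this
  induction F using MvPolynomial.induction_on with
  | C r => rw [MvPolynomial.aeval_C]; exact (polyFun k M).algebraMap_mem r
  | add p q hp hq => rw [map_add]; exact add_mem hp hq
  | mul_X p i hp =>
    rw [map_mul, MvPolynomial.aeval_X]
    exact mul_mem hp (Algebra.subset_adjoin ⟨l i, rfl⟩)

/-- If `m` lies in the Zariski closure of the set of all `B(e, e⁻¹)`, then there is an arc through
`m`. The hypothesis says that the coordinates of `m` satisfy all relations between those of `B(g,
g⁻¹)` for the generic unit `g`, so that `exists_model` and `exists_discrete_place` apply. -/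
theorem exists_arc [IsAlgClosed k] (B : E →ₗ[k] E →ₗ[k] M) (m : M)
    (hm : ∀ F ∈ polyFun k M, (∀ e : Eˣ, F (B e ↑e⁻¹) = 0) → F m = 0) :
    ∃ (O : Type u) (_ : CommRing O) (_ : Algebra k O), Nonempty (Arc B m O) := by
  obtain ⟨T, _, _, _, _, g, h, hgh, hhg, hev⟩ := exists_generic_unit k E
  let b := Module.finBasis k M
  let x := bilinExt B T g h
  let y : Fin (Module.finrank k M) → T := fun j =>
    TensorProduct.lid k T (LinearMap.rTensor T (b.coord j) x)
  have hxy (z : M ⊗[k] T) :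
      z = ∑ j, b j ⊗ₜ[k] TensorProduct.lid k T (LinearMap.rTensor T (b.coord j) z) := by
    induction z using TensorProduct.induction_on with
    | zero => simp
    | add z z' hz hz' =>
      conv_lhs => rw [hz, hz']
      simp [TensorProduct.tmul_add, Finset.sum_add_distrib]
    | tmul v a =>
      simp only [LinearMap.rTensor_tmul, TensorProduct.lid_tmul, ← TensorProduct.smul_tmul,
        ← TensorProduct.sum_tmul, Module.Basis.coord_apply, b.sum_repr]
  have hx : x = ∑ j, b j ⊗ₜ[k] y j := hxy x
  have hT : IsConj B (1 : T) g h x := ⟨hgh, hhg, by simp [x]⟩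
  obtain ⟨S, c, e, hSfin, hc0, hcS, hS⟩ := exists_model y (b.repr m) fun F hF => by
    have := hm _ (eval_mem_polyFun (fun j => b.coord j) F) fun u => by
      obtain ⟨φ, hφg, hφh⟩ := hev u
      rw [← hφg, ← hφh, ← evalAt_bilinExt]
      have : (fun j => b.coord j (evalAt M φ (bilinExt B T g h))) = fun j => φ (y j) := by
        funext j
        rw [show bilinExt B T g h = _ from hx]
        simp [evalAt_tmul, Finsupp.single_apply]
      rw [this]
      have h1 := congrArg φ hF
      rw [map_zero] at h1
      rw [← h1]
      exact (DFunLike.congr_fun (MvPolynomial.comp_aeval (R := k) y φ) F).symm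
    exact this
  choose a ha hae using hS
  let τ : T →ₐ[k] FractionRing T := Algebra.algHom k T _
  obtain ⟨n, g₁, hg₁⟩ := exists_scalarMap_eq τ S c hcS g
  obtain ⟨n', h₁, hh₁⟩ := exists_scalarMap_eq τ S c hcS h
  let x₁ : M ⊗[k] S := ∑ j, b j ⊗ₜ[k] a j
  have hS : IsConj B (c ^ n' * (c ^ n * 1)) g₁ h₁ x₁ := by
    refine IsConj.of_map (φ := S.val) Subtype.val_injective ?_
    have := ((hT.map τ).scale_left ((c : FractionRing T) ^ n)).scale_right
      ((c : FractionRing T) ^ n')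
    rw [← hg₁, ← hh₁] at this
    convert this using 1
    · simp
    · simp only [x₁, hx, map_sum, LinearMap.lTensor_tmul]
      exact Finset.sum_congr rfl fun j _ => congrArg _ (ha j)
  -- `exists_discrete_place` wants a denominator vanishing at the point, which `c` need not do;
  -- it is replaced by `c X`, after passing to `S[X]` and the point `X = 0`
  have : IsNoetherianRing S := Algebra.FiniteType.isNoetherianRing k S
  let e' : Polynomial S →ₐ[k] k := e.comp ((Polynomial.aeval (0 : S)).restrictScalars k)
  obtain ⟨O, _, _, _, t, ε, θ, ht0, hεt, hdvd, hεθ, l, hl⟩ := exists_discrete_place e'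
    (f := Polynomial.C c * Polynomial.X) (mul_ne_zero (by simpa using hc0) Polynomial.X_ne_zero)
    (by simp [e'])
  let ψ : S →ₐ[k] O := θ.comp Polynomial.CAlgHom
  obtain ⟨r, hr⟩ : ψ c ∣ t ^ l := (Dvd.intro _ (map_mul θ _ _).symm).trans hl
  have hO := (hS.map ψ).scale_left (r ^ (n + n'))
  have hpow : r ^ (n + n') * ψ (c ^ n' * (c ^ n * 1)) = t ^ (l * (n + n')) := by
    rw [mul_one, ← pow_add, map_pow, pow_mul, hr, mul_pow, add_comm n', mul_comm]
  rw [hpow] at hO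
  refine ⟨O, _, _, ⟨⟨t, ε, _, _, _, _, IsLeftCancelMulZero.mul_left_cancel_of_ne_zero ht0,
    hεt, hdvd, hO.gh, hO.hg, hO.bilin, ?_⟩⟩⟩
  have hεψ (s : S) : ε (ψ s) = e s := (hεθ _).trans (by simp [e'])
  simp only [x₁, map_sum, LinearMap.lTensor_tmul, evalAt_tmul, AlgHom.toLinearMap_apply, hεψ, hae]
  exact b.sum_repr m

end ExistsArc

/-! ### Zariski closure and rational curves -/

section RationalCurve

open Polynomial

/-- A function `k → k` that agrees with a rational function regular at `0` wherever a denominator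
of the latter does not vanish. -/
def IsRationalAtZero {k : Type*} [Field k] (f : k → k) : Prop :=
  ∃ p q : k[X], q.eval 0 ≠ 0 ∧ ∀ c, q.eval c ≠ 0 → f c * q.eval c = p.eval c

namespace IsRationalAtZero

variable {k : Type*} [Field k] {f g : k → k}

theorem eval (p : k[X]) : IsRationalAtZero fun c => p.eval c :=
  ⟨p, 1, by simp, by simp⟩

theorem add (hf : IsRationalAtZero f) (hg : IsRationalAtZero g) : IsRationalAtZero (f + g) := by
  obtain ⟨p, q, hq, h⟩ := hf
  obtain ⟨p', q', hq', h'⟩ := hg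
  refine ⟨p * q' + p' * q, q * q', by simp [hq, hq'], fun c hc => ?_⟩
  rw [eval_mul] at hc
  have h1 := h c (left_ne_zero_of_mul hc)
  have h2 := h' c (right_ne_zero_of_mul hc)
  simp only [Pi.add_apply, eval_mul, eval_add, ← h1, ← h2]
  ring

theorem mul (hf : IsRationalAtZero f) (hg : IsRationalAtZero g) : IsRationalAtZero (f * g) := by
  obtain ⟨p, q, hq, h⟩ := hf
  obtain ⟨p', q', hq', h'⟩ := hg
  refine ⟨p * p', q * q', by simp [hq, hq'], fun c hc => ?_⟩
  rw [eval_mul] at hc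
  have h1 := h c (left_ne_zero_of_mul hc)
  have h2 := h' c (right_ne_zero_of_mul hc)
  simp only [Pi.mul_apply, eval_mul, ← h1, ← h2]
  ring

theorem inv_eval (q : k[X]) (hq : q.eval 0 ≠ 0) : IsRationalAtZero fun c => (q.eval c)⁻¹ :=
  ⟨1, q, hq, fun c hc => by simp [hc]⟩

/-- A function that is regular at `0` and vanishes off finitely many points vanishes at `0`. -/
theorem eq_zero [Infinite k] (hf : IsRationalAtZero f) {r : k[X]} (hr : r ≠ 0)
    (h : ∀ c, r.eval c ≠ 0 → f c = 0) : f 0 = 0 := by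
  obtain ⟨p, q, hq, hpq⟩ := hf
  have hq0 : q ≠ 0 := fun h0 => hq (by simp [h0])
  have hp : p * (q * r) = 0 := Polynomial.funext fun c => by
    rw [eval_zero, eval_mul, eval_mul]
    by_cases hc : q.eval c = 0
    · simp [hc]
    by_cases hc' : r.eval c = 0
    · simp [hc']
    · rw [← hpq c hc, h c hc']; simp
  have hp0 : p = 0 := by simpa [hq0, hr] using hp
  have := hpq 0 hq
  rw [hp0, eval_zero] at this
  exact (mul_eq_zero.1 this).resolve_right hq

end IsRationalAtZero

theorem isClosed_zariski_iff {k M : Type u} [Field k] [AddCommGroup M] [Module k M] {Z : Set M} :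
    @IsClosed M (zariskiTopology k M) Z ↔
      ∃ I ⊆ (polyFun k M : Set (M → k)), Z = zeroLocus k M I := by
  let _ := zariskiTopology k M
  rw [← isOpen_compl_iff]
  change Zᶜᶜ ∈ _ ↔ _
  rw [compl_compl]
  rfl

/-- A point lies in the Zariski closure of `Ω` if and only if every polynomial function vanishing on
`Ω` vanishes there. -/
theorem mem_zariski_closure_iff {k M : Type u} [Field k] [AddCommGroup M] [Module k M] {Ω : Set M}
    {x : M} : x ∈ @closure M (zariskiTopology k M) Ω ↔
      ∀ F ∈ polyFun k M, (∀ y ∈ Ω, F y = 0) → F x = 0 := by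
  let _ := zariskiTopology k M
  constructor
  · intro hx F hF hΩ
    have hcl : IsClosed (zeroLocus k M {F}) :=
      isClosed_zariski_iff.2 ⟨{F}, Set.singleton_subset_iff.2 hF, rfl⟩
    have hsub : Ω ⊆ zeroLocus k M {F} := fun y hy f hf => by
      rw [Set.mem_singleton_iff.1 hf]; exact hΩ y hy
    exact closure_minimal hsub hcl hx F rfl
  · intro h
    rw [closure, Set.mem_sInter]
    rintro Z ⟨hZ, hΩ⟩
    obtain ⟨I, hI, rfl⟩ := isClosed_zariski_iff.1 hZ
    exact fun f hf => h f (hI hf) fun y hy => hΩ hy f hf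

/-- A rational curve that runs in `Ω` generically stays in the Zariski closure of `Ω`. -/
theorem mem_closure_of_rational_curve {k M : Type u} [Field k] [Infinite k] [AddCommGroup M]
    [Module k M] {Ω : Set M} {γ : k → M}
    (hγ : ∀ l : Module.Dual k M, IsRationalAtZero fun c => l (γ c)) {r : k[X]} (hr : r ≠ 0)
    (h : ∀ c, r.eval c ≠ 0 → γ c ∈ Ω) : γ 0 ∈ @closure M (zariskiTopology k M) Ω := by
  refine mem_zariski_closure_iff.2 fun F hF hΩ => ?_
  have key : IsRationalAtZero fun c => F (γ c) := by
    clear hΩ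
    induction hF using Algebra.adjoin_induction with
    | mem F hF =>
      obtain ⟨l, rfl⟩ := hF
      exact hγ l
    | algebraMap a => simpa using IsRationalAtZero.eval (C a)
    | add F G _ _ hF hG => exact hF.add hG
    | mul F G _ _ hF hG => exact hF.mul hG
  exact key.eq_zero hr fun c hc => hΩ _ (h c hc)

variable {k E : Type*} [Field k] [Ring E] [Algebra k E]

/-- The resolvent `(1 - c n)⁻¹` is a rational function of `c`, regular at `0`. If `∑ pᵢ nⁱ = 0` is
an integral equation of degree `d`, multiply it by `c ^ d` and compare with `q(c) = ∑ pᵢ c ^ (d -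
i)`: the difference is `q(c) = ∑ pᵢ c ^ (d - i) (1 - (c n)ⁱ)`, a multiple of `1 - c n`. -/
theorem exists_resolvent {n : E} (hn : IsIntegral k n) : ∃ (R : k → E) (q : k[X]), q.eval 0 ≠ 0 ∧
    (∀ c, q.eval c ≠ 0 → (1 - c • n) * R c = 1 ∧ R c * (1 - c • n) = 1) ∧
    ∀ l : Module.Dual k E, IsRationalAtZero fun c => l (R c) := by
  obtain ⟨p, hp, hpn⟩ := hn
  let d := p.natDegree
  let q : k[X] := ∑ i ∈ Finset.range (d + 1), C (p.coeff i) * X ^ (d - i)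
  let S : k → E := fun c =>
    ∑ i ∈ Finset.range (d + 1), (p.coeff i * c ^ (d - i)) • ∑ j ∈ Finset.range i, (c • n) ^ j
  have hq (c : k) : q.eval c = ∑ i ∈ Finset.range (d + 1), p.coeff i * c ^ (d - i) := by
    simp [q, eval_finsetSum]
  have hpn' : ∑ i ∈ Finset.range (d + 1), p.coeff i • n ^ i = 0 := by
    rw [← hpn, eval₂_eq_sum_range]
    simp [d, Algebra.smul_def]
  have hS (c : k) : (1 - c • n) * S c = q.eval c • 1 := by
    have h1 : ∑ i ∈ Finset.range (d + 1), (p.coeff i * c ^ (d - i)) • (c • n) ^ i = 0 := by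
      rw [← smul_zero (c ^ d), ← hpn', Finset.smul_sum]
      refine Finset.sum_congr rfl fun i hi => ?_
      have : i ≤ d := Nat.lt_succ_iff.1 (Finset.mem_range.1 hi)
      rw [_root_.smul_pow, smul_smul, smul_smul, mul_assoc, ← pow_add, Nat.sub_add_cancel this,
        mul_comm]
    simp only [S, Finset.mul_sum (s := Finset.range (d + 1)), mul_smul_comm, mul_neg_geom_sum,
      smul_sub, Finset.sum_sub_distrib, h1, sub_zero, hq, Finset.sum_smul]
  have hcomm (c : k) : Commute (1 - c • n) (S c) := by
    refine Commute.sum_right _ _ _ fun i _ => Commute.smul_right (Commute.sum_right _ _ _ fun j _ =>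
      Commute.pow_right ?_ j) _
    exact (Commute.one_left _).sub_left (Commute.refl _)
  have hq0 : q.eval 0 ≠ 0 := by
    rw [hq, Finset.sum_range_succ, Finset.sum_eq_zero]
    · simp [d, hp]
    · intro i hi
      have : d - i ≠ 0 := (Nat.sub_pos_of_lt (Finset.mem_range.1 hi)).ne'
      simp [this]
  refine ⟨fun c => (q.eval c)⁻¹ • S c, q, hq0, fun c hc => ⟨?_, ?_⟩, fun l => ?_⟩
  · rw [mul_smul_comm, hS, smul_smul, inv_mul_cancel₀ hc, one_smul]
  · rw [smul_mul_assoc, ← (hcomm c).eq, hS, smul_smul, inv_mul_cancel₀ hc, one_smul]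
  · let L : k[X] := ∑ i ∈ Finset.range (d + 1), (C (p.coeff i) * X ^ (d - i)) *
      ∑ j ∈ Finset.range i, X ^ j * C (l (n ^ j))
    have hL (c : k) : L.eval c = l (S c) := by
      simp only [L, S, eval_finsetSum, eval_mul, eval_C, eval_pow, eval_X, map_sum, map_smul,
        _root_.smul_pow, smul_eq_mul]
    have := (IsRationalAtZero.inv_eval q hq0).mul (IsRationalAtZero.eval L)
    convert this using 2 with c
    rw [Pi.mul_apply, hL, map_smul, smul_eq_mul]

/-- An integral element has only finitely many spectral values: all are roots of its integral
equation. -/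
theorem exists_isUnit_sub {b : E} (hb : IsIntegral k b) :
    ∃ r : k[X], r ≠ 0 ∧ ∀ c, r.eval c ≠ 0 → IsUnit (b - algebraMap k E c) := by
  obtain ⟨p, hp, hpb⟩ := hb
  refine ⟨p, hp.ne_zero, fun c hc => ?_⟩
  obtain ⟨s, hs⟩ := X_sub_C_dvd_sub_C_eval (a := c) (p := p)
  have h1 := congrArg (aeval b) hs
  have h2 : aeval b p = 0 := hpb
  rw [map_sub, h2, map_mul, map_sub, aeval_X, aeval_C, aeval_C, zero_sub] at h1
  have h3 : Commute (b - algebraMap k E c) (aeval b s) := by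
    have := (Commute.all (X - C c) s).map (aeval b)
    rwa [map_sub, aeval_X, aeval_C] at this
  refine (h3.isUnit_mul_iff.1 ?_).1
  rw [← h1]
  exact ((isUnit_iff_ne_zero.2 hc).map (algebraMap k E)).neg

end RationalCurve

/-! ### Degenerations from conflations -/

section Converse

open Polynomial

variable {k A W : Type u} [Field k] [Ring A] [Algebra k A]
  [AddCommGroup W] [Module k W] [Module A W] [Module Aᵐᵒᵖ W]
  [IsScalarTower k A W] [IsScalarTower k Aᵐᵒᵖ W] [SMulCommClass A Aᵐᵒᵖ W]
  {P Q : Type u}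
  [AddCommGroup P] [Module k P] [Module A P] [IsScalarTower k A P] [Module.Finite k P]
  [AddCommGroup Q] [Module k Q] [Module A Q] [IsScalarTower k A Q] [Module.Finite k Q]

theorem mem_glOrbit_of_bijective {w w' : Elts k A W P} {g : P →ₗ[A] P} (hg : Intertwines w w' g)
    (hb : Function.Bijective g) : w' ∈ glOrbit w := by
  let e := LinearEquiv.ofBijective g hb
  refine ⟨e, LinearMap.ext fun x => ?_⟩
  change bmap k A W g (w (e.symm x)) = w' x
  rw [hg.apply]
  exact congrArg w' (e.apply_symm_apply x)

/-- The variant of `mem_glOrbit_of_bijective` for an isomorphism in the opposite direction. -/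
theorem mem_glOrbit_of_bijective' {w w' : Elts k A W P} {g : P →ₗ[A] P} (hg : Intertwines w' w g)
    (hb : Function.Bijective g) : w' ∈ glOrbit w := by
  let e := LinearEquiv.ofBijective g hb
  refine mem_glOrbit_of_bijective (g := e.symm) (LinearMap.ext fun x => ?_) e.symm.bijective
  obtain ⟨y, rfl⟩ := e.surjective x
  rw [LinearMap.comp_apply, LinearMap.comp_apply, LinearEquiv.coe_coe, e.symm_apply_apply]
  change bmap k A W e.symm.toLinearMap (w (g y)) = w' y
  rw [← hg.apply, bmap_bmap]
  have : e.symm.toLinearMap ∘ₗ g = LinearMap.id := LinearMap.ext fun x => e.symm_apply_apply x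
  rw [this, bmap_id, LinearMap.id_apply]

/-- A bilinear expression in a family `R` that is rational at `0` and the line `1 - c n` is rational
at `0`. -/
theorem isRationalAtZero_pencil {E M : Type*} [Ring E] [Algebra k E]
    [AddCommGroup M] [Module k M] (T : E →ₗ[k] E →ₗ[k] M)
    {R : k → E} (hR : ∀ l : Module.Dual k E, IsRationalAtZero fun c => l (R c))
    (n : E) (l : Module.Dual k M) :
    IsRationalAtZero fun c => l (T (R c) (1 - c • n)) := by
  have := (hR (l ∘ₗ T.flip 1)).add
    ((IsRationalAtZero.eval (-X : k[X])).mul (hR (l ∘ₗ T.flip n)))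
  convert this using 2 with c
  simp [sub_eq_add_neg]

/-- A section of a short exact sequence determines the complementary retraction. -/
theorem exists_retraction_of_section {R X Y Z : Type*} [Ring R] [AddCommGroup X] [AddCommGroup Y]
    [AddCommGroup Z] [Module R X] [Module R Y] [Module R Z] {α : X →ₗ[R] Y} {β : Y →ₗ[R] Z}
    (hinj : Function.Injective α) (hex : Function.Exact α β) {s : Z →ₗ[R] Y}
    (hs : ∀ z, β (s z) = z) : ∃ r : Y →ₗ[R] X, ∀ y, α (r y) + s (β y) = y := by
  have (x : Y) : ∃ z, α z = x - s (β x) :=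
    (hex _).1 (by rw [map_sub, hs, sub_self])
  choose r hr using this
  exact ⟨{ toFun := r
           map_add' := fun x y => hinj (by rw [map_add, hr, hr, hr, map_add, map_add]; abel)
           map_smul' := fun a x => hinj (by
            rw [RingHom.id_apply, map_smul, hr, hr, map_smul, map_smul, smul_sub]) },
    fun x => by simp [hr]⟩

/-- With a section `s` of `β`, a retraction `r` of `α` and `n = inr ∘ r`, the automorphism `1 - c n`
of `P ⊕ Q` (for all but finitely many `c`) maps the image of `α` onto that of `α_c = α - c inr`.
Identifying the cokernel of `α_c` with `P` by means of the complement `(1 - c n) s P`, one obtains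
from `w ⊕ v` an element of `W(P)` which varies rationally with `c` and equals `w'` at `c = 0`. On
the other hand, if `c` is not an eigenvalue of `snd ∘ α`, then `inl P` is a complement of the image
of `α_c` as well, and the element is isomorphic to `w`. -/
theorem degenerates_of_conflation_left [Infinite k] [Module.Projective A P] {w w' : Elts k A W P}
    {v : Elts k A W Q} {α : Q →ₗ[A] P × Q} {β : P × Q →ₗ[A] P}
    (hα : Intertwines v (sumElt k A W w v) α) (hβ : Intertwines (sumElt k A W w v) w' β)
    (hinj : Function.Injective α) (hex : Function.Exact α β) (hsurj : Function.Surjective β) :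
    Degenerates w w' := by
  obtain ⟨s, hs⟩ := LinearMap.exists_rightInverse_of_surjective β (LinearMap.range_eq_top.2 hsurj)
  have hβs (p : P) : β (s p) = p := LinearMap.congr_fun hs p
  have hβα (z : Q) : β (α z) = 0 := (hex _).2 ⟨z, rfl⟩
  obtain ⟨r, hr⟩ := exists_retraction_of_section hinj hex hβs
  have hrα (z : Q) : r (α z) = z := hinj (by
    have := hr (α z)
    rwa [hβα, map_zero, add_zero] at this)
  let n : Module.End A (P × Q) := LinearMap.inr A P Q ∘ₗ r
  let αc (c : k) : Q →ₗ[A] P × Q := α - c • LinearMap.inr A P Q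
  have hαc (c : k) : Intertwines v (sumElt k A W w v) (αc c) := hα.sub (Intertwines.inr.smul c)
  have hnα (c : k) (z : Q) : (1 - c • n) (α z) = αc c z := by simp [n, αc, hrα]
  obtain ⟨R, q, hq, hqR, hR⟩ := exists_resolvent (Algebra.IsIntegral.isIntegral (R := k) n)
  obtain ⟨ρ, hρ, hρu⟩ := exists_isUnit_sub (Algebra.IsIntegral.isIntegral (R := k)
    (LinearMap.snd A P Q ∘ₗ α : Module.End A Q))
  -- `T (R c) (1 - c n)` is the cokernel of `α_c`, transported to `P`
  let T : Module.End A (P × Q) →ₗ[k] Module.End A (P × Q) →ₗ[k] Elts k A W P :=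
    LinearMap.mk₂ k (fun x y => bmap k A W (β ∘ₗ x) ∘ₗ sumElt k A W w v ∘ₗ y ∘ₗ s)
      (fun x x' y => by rw [LinearMap.comp_add, bmap_add, LinearMap.add_comp])
      (fun c x y => by rw [LinearMap.comp_smul, bmap_smul, LinearMap.smul_comp])
      (fun x y y' => by simp only [LinearMap.add_comp, LinearMap.comp_add])
      (fun c x y => by
        ext z
        simp only [LinearMap.comp_apply, LinearMap.smul_apply, LinearMap.map_smul_of_tower])
  have hT (x y : Module.End A (P × Q)) :
      T x y = bmap k A W (β ∘ₗ x) ∘ₗ sumElt k A W w v ∘ₗ y ∘ₗ s := rfl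
  have h0 : T (R 0) (1 - (0 : k) • n) = w' := by
    have hR0 : R 0 = 1 := by simpa using (hqR 0 hq).1
    ext z
    rw [hT, hR0, zero_smul, sub_zero, LinearMap.comp_apply]
    exact (hβ.apply _).trans (congrArg w' (hβs z))
  rw [Degenerates, ← h0]
  have hq0 : q ≠ 0 := by rintro rfl; simp at hq
  refine mem_closure_of_rational_curve (γ := fun c => T (R c) (1 - c • n))
    (isRationalAtZero_pencil T hR n) (mul_ne_zero hq0 hρ) fun c hc => ?_
  rw [eval_mul] at hc
  obtain ⟨h1, h2⟩ := hqR c (left_ne_zero_of_mul hc)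
  have h1' (x : P × Q) : (1 - c • n) (R c x) = x := LinearMap.congr_fun h1 x
  have h2' (x : P × Q) : R c ((1 - c • n) x) = x := LinearMap.congr_fun h2 x
  have hbij := (Module.End.isUnit_iff _).1 (hρu c (right_ne_zero_of_mul hc))
  have hkill : (β ∘ₗ R c) ∘ₗ αc c = 0 := LinearMap.ext fun z => by
    rw [LinearMap.comp_apply, LinearMap.comp_apply, ← hnα, h2', hβα, LinearMap.zero_apply]
  let g : P →ₗ[A] P := (β ∘ₗ R c) ∘ₗ LinearMap.inl A P Q
  refine mem_glOrbit_of_bijective (g := g) (LinearMap.ext fun p => ?_) ?_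
  · have e1 : (1 - c • n) (s (g p)) = LinearMap.inl A P Q p - αc c (r (R c (p, 0))) := by
      have e : s (g p) = R c (LinearMap.inl A P Q p) - α (r (R c (LinearMap.inl A P Q p))) :=
        eq_sub_of_add_eq' (hr _)
      rw [e, map_sub, h1', hnα]
      rfl
    rw [hT]
    simp only [LinearMap.comp_apply]
    rw [e1, map_sub, map_sub, ← (hαc c).apply, bmap_bmap, hkill, bmap_zero,
      LinearMap.zero_apply, sub_zero, ← Intertwines.inl.apply, bmap_bmap]
  · have hs : Function.Surjective g := fun p => by
      obtain ⟨y, hy⟩ := hsurj p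
      obtain ⟨ζ, hζ⟩ := hbij.2 ((1 - c • n) y).2
      refine ⟨((1 - c • n) y - αc c ζ).1, ?_⟩
      have e2 : LinearMap.inl A P Q ((1 - c • n) y - αc c ζ).1 = (1 - c • n) y - αc c ζ := by
        refine Prod.ext rfl ?_
        rw [Prod.snd_sub, ← hζ]
        simp [αc, Algebra.algebraMap_eq_smul_one]
      have e3 := LinearMap.congr_fun hkill ζ
      rw [LinearMap.comp_apply, LinearMap.zero_apply] at e3
      rw [LinearMap.comp_apply, e2, map_sub, e3, sub_zero, LinearMap.comp_apply, h2', hy]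
    exact ⟨(LinearMap.injective_iff_surjective (f := g.restrictScalars k)).2 hs, hs⟩

/-- The dual of `degenerates_of_conflation_left`: with a section `s` of `β` and `n = s ∘ snd` one
has `β (1 - c n) = β_c` for the pencil `β_c = β - c snd`. The kernel of `β_c` is therefore the image
of `α` under the resolvent of `n`, and it is complementary to `inr Q`, hence isomorphic to `w`,
unless `c` is an eigenvalue of `β ∘ inr`. -/
theorem degenerates_of_conflation_right [Infinite k] [Module.Projective A Q] {w w' : Elts k A W P}
    {v : Elts k A W Q} {α : P →ₗ[A] P × Q} {β : P × Q →ₗ[A] Q}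
    (hα : Intertwines w' (sumElt k A W w v) α) (hβ : Intertwines (sumElt k A W w v) v β)
    (hinj : Function.Injective α) (hex : Function.Exact α β) (hsurj : Function.Surjective β) :
    Degenerates w w' := by
  obtain ⟨s, hs⟩ := LinearMap.exists_rightInverse_of_surjective β (LinearMap.range_eq_top.2 hsurj)
  have hβs (p : Q) : β (s p) = p := LinearMap.congr_fun hs p
  have hβα (z : P) : β (α z) = 0 := (hex _).2 ⟨z, rfl⟩
  obtain ⟨r, hr⟩ := exists_retraction_of_section hinj hex hβs
  have hrα (z : P) : r (α z) = z := hinj (by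
    have := hr (α z)
    rwa [hβα, map_zero, add_zero] at this)
  let n : Module.End A (P × Q) := s ∘ₗ LinearMap.snd A P Q
  let βc (c : k) : P × Q →ₗ[A] Q := β - c • LinearMap.snd A P Q
  have hβc (c : k) : Intertwines (sumElt k A W w v) v (βc c) := hβ.sub (Intertwines.snd.smul c)
  have hβn (c : k) (x : P × Q) : β ((1 - c • n) x) = βc c x := by
    simp [n, βc, hβs, LinearMap.map_smul_of_tower]
  obtain ⟨R, q, hq, hqR, hR⟩ := exists_resolvent (Algebra.IsIntegral.isIntegral (R := k) n)
  obtain ⟨ρ, hρ, hρu⟩ := exists_isUnit_sub (Algebra.IsIntegral.isIntegral (R := k)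
    (β ∘ₗ LinearMap.inr A P Q : Module.End A Q))
  -- `T (R c) (1 - c n)` is the kernel of `β_c`, transported to `P`
  let T : Module.End A (P × Q) →ₗ[k] Module.End A (P × Q) →ₗ[k] Elts k A W P :=
    LinearMap.mk₂ k (fun y x => bmap k A W (r ∘ₗ x) ∘ₗ sumElt k A W w v ∘ₗ y ∘ₗ α)
      (fun x y y' => by simp only [LinearMap.add_comp, LinearMap.comp_add])
      (fun c x y => by
        ext z
        simp only [LinearMap.comp_apply, LinearMap.smul_apply, LinearMap.map_smul_of_tower])
      (fun x x' y => by rw [LinearMap.comp_add, bmap_add, LinearMap.add_comp])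
      (fun c x y => by rw [LinearMap.comp_smul, bmap_smul, LinearMap.smul_comp])
  have hT (y x : Module.End A (P × Q)) :
      T y x = bmap k A W (r ∘ₗ x) ∘ₗ sumElt k A W w v ∘ₗ y ∘ₗ α := rfl
  have h0 : T (R 0) (1 - (0 : k) • n) = w' := by
    have hR0 : R 0 = 1 := by simpa using (hqR 0 hq).1
    ext z
    rw [hT, hR0, zero_smul, sub_zero]
    change bmap k A W r (sumElt k A W w v (α z)) = w' z
    rw [← hα.apply, bmap_bmap, show r ∘ₗ α = LinearMap.id from LinearMap.ext hrα, bmap_id,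
      LinearMap.id_apply]
  rw [Degenerates, ← h0]
  have hq0 : q ≠ 0 := by rintro rfl; simp at hq
  refine mem_closure_of_rational_curve (γ := fun c => T (R c) (1 - c • n))
    (isRationalAtZero_pencil T hR n) (mul_ne_zero hq0 hρ) fun c hc => ?_
  rw [eval_mul] at hc
  obtain ⟨h1, h2⟩ := hqR c (left_ne_zero_of_mul hc)
  have h1' (x : P × Q) : (1 - c • n) (R c x) = x := LinearMap.congr_fun h1 x
  have h2' (x : P × Q) : R c ((1 - c • n) x) = x := LinearMap.congr_fun h2 x
  have hbij := (Module.End.isUnit_iff _).1 (hρu c (right_ne_zero_of_mul hc))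
  have hkill (p : P) : βc c (R c (α p)) = 0 := by rw [← hβn, h1', hβα]
  let g : P →ₗ[A] P := LinearMap.fst A P Q ∘ₗ R c ∘ₗ α
  refine mem_glOrbit_of_bijective' (g := g) (LinearMap.ext fun p => ?_) ?_
  · have e1 : g ∘ₗ r ∘ₗ (1 - c • n) =
        LinearMap.fst A P Q - (LinearMap.fst A P Q ∘ₗ R c ∘ₗ s) ∘ₗ βc c := by
      refine LinearMap.ext fun x => ?_
      have := hr ((1 - c • n) x)
      rw [hβn, ← eq_sub_iff_add_eq] at this
      change LinearMap.fst A P Q (R c (α (r ((1 - c • n) x)))) =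
        LinearMap.fst A P Q x - LinearMap.fst A P Q (R c (s (βc c x)))
      rw [this, map_sub, h2', map_sub]
    rw [hT]
    simp only [LinearMap.comp_apply]
    rw [bmap_bmap, e1, sub_eq_add_neg, ← neg_one_smul k, bmap_add, bmap_smul, LinearMap.add_apply,
      LinearMap.smul_apply, ← bmap_bmap, (hβc c).apply, hkill, map_zero, map_zero, smul_zero,
      add_zero, Intertwines.fst.apply]
    rfl
  · have hi : Function.Injective g := by
      rw [injective_iff_map_eq_zero]
      intro p hp
      have hk := hkill p
      have e2 : R c (α p) = LinearMap.inr A P Q (R c (α p)).2 := Prod.ext hp rfl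
      rw [e2] at hk
      have e3 : (R c (α p)).2 = 0 := by
        refine (injective_iff_map_eq_zero _).1 hbij.1 _ (Eq.trans ?_ hk)
        simp [βc, Algebra.algebraMap_eq_smul_one]
      rw [e3, map_zero] at e2
      refine hinj ?_
      rw [map_zero, ← h1' (α p), e2, map_zero]
    exact ⟨hi, (LinearMap.injective_iff_surjective (f := g.restrictScalars k)).1 hi⟩

end Converse

section Forward

variable {k A W : Type u} [Field k] [Ring A] [Algebra k A]
  [AddCommGroup W] [Module k W] [Module A W] [Module Aᵐᵒᵖ W]
  [IsScalarTower k A W] [IsScalarTower k Aᵐᵒᵖ W] [SMulCommClass A Aᵐᵒᵖ W]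
  [FiniteDimensional k W]
  {P : Type u}
  [AddCommGroup P] [Module k P] [Module A P] [IsScalarTower k A P] [Module.Finite k P]

/-- A degeneration is realised by a family over an arc. -/
theorem Degenerates.exists_latticeData [IsAlgClosed k] {w w' : Elts k A W P}
    (h : Degenerates w w') :
    ∃ (O : Type u) (_ : CommRing O) (_ : Algebra k O), Nonempty (LatticeData w w' (P ⊗[k] O)) := by
  have : Module.Finite k (BTensor k A W P) :=
    Module.Finite.quotient k (balancedRel k A W P)
  have key (F : Elts k A W P → k) (hF : F ∈ polyFun k (Elts k A W P))
      (hu : ∀ e : (Module.End A P)ˣ, F (sandwich w e ↑e⁻¹) = 0) : F w' = 0 := by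
    refine mem_zariski_closure_iff.1 h F hF ?_
    rintro _ ⟨g, rfl⟩
    exact hu ⟨(g : P →ₗ[A] P), g.symm, LinearMap.ext g.apply_symm_apply,
        LinearMap.ext g.symm_apply_apply⟩
  obtain ⟨O, _, _, ⟨D⟩⟩ := exists_arc (sandwich w) w' key
  exact ⟨O, _, _, ⟨D.latticeData⟩⟩

end Forward

end BimoduleEl

open BimoduleEl in
theorem theorem2p1 {k A W P : Type u}
    [Field k] [IsAlgClosed k]
    [Ring A] [Algebra k A] [FiniteDimensional k A]
    [AddCommGroup W] [Module k W] [Module A W] [Module Aᵐᵒᵖ W]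
    [IsScalarTower k A W] [IsScalarTower k Aᵐᵒᵖ W] [SMulCommClass A Aᵐᵒᵖ W]
    [FiniteDimensional k W]
    [AddCommGroup P] [Module k P] [Module A P] [IsScalarTower k A P]
    [Module.Finite A P] [Module.Projective A P]
    (w w' : Elts k A W P) :
    List.TFAE [
      Degenerates w w',
      ∃ (v : El k A W) (α : El.mk P w' ⟶ (El.mk P w).dsum v) (β : (El.mk P w).dsum v ⟶ v),
        IsConflation α β,
      ∃ (v : El k A W) (α : v ⟶ (El.mk P w).dsum v) (β : (El.mk P w).dsum v ⟶ El.mk P w'),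
        IsConflation α β] := by
  have : Module.Finite k P := Module.Finite.trans A P
  have : Infinite k := IsAlgClosed.instInfinite
  tfae_have 1 → 2 := fun h => by
    obtain ⟨O, _, _, ⟨D⟩⟩ := h.exists_latticeData
    exact D.exists_conflation_right
  tfae_have 1 → 3 := fun h => by
    obtain ⟨O, _, _, ⟨D⟩⟩ := h.exists_latticeData
    exact D.exists_conflation_left
  tfae_have 2 → 1 := by
    rintro ⟨v, α, β, hinj, hex, hsurj⟩
    have : Module.Finite k v.carrier := Module.Finite.trans A _
    exact degenerates_of_conflation_right α.comm β.comm hinj hex hsurj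
  tfae_have 3 → 1 := by
    rintro ⟨v, α, β, hinj, hex, hsurj⟩
    have : Module.Finite k v.carrier := Module.Finite.trans A _
    exact degenerates_of_conflation_left α.comm β.comm hinj hex hsurj
  tfae_finish
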